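/- Theorem 3.1. Let $f\in C([0,1]\times\mathbb R^2,\mathbb R)$ and $k\in C([0,1]\times[0,1],\mathbb R)$ with $k\ge 0$, and consider the boundary value problem $$y^{(4)}(x)=f\Big(x,y(x),\int_0^1k(x,t)y(t)\,dt\Big),\ x\in(0,1),\qquad y(0)=y(1)=y''(0)=y''(1)=0. \tag{1}$$ A function $\alpha\in C^4[0,1]$ is a lower solution of (1) if $\alpha^{(4)}(x)\le f(x,\alpha(x),\int_0^1k(x,t)\alpha(t)\,dt)$ for $x\in(0,1)$ and $\alpha(0)\le0$, $\alpha(1)\le0$, $\alpha''(0)\ge0$, $\alpha''(1)\ge0$; an upper solution $\beta\in C^4[0,1]$ is defined by reversing all these inequalities. Solutions of (1) are understood in $C^4[0,1]$. Let $c_1=4\kappa_1^4\approx125.14$, where $\kappa_1$ is the smallest positive solution of $\tan\kappa=-\tanh\kappa$. For $M>0$ let $G$ be the Green function of $y^{(4)}+My$ on $[0,1]$ under the conditions $y(0)=y(1)=y''(0)=y''(1)=0$. Write $\|k\|_\infty=\max_{[0,1]^2}|k|$. Let $\alpha$ be a lower and $\beta$ an upper solution of (1) with $\alpha\le\beta$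 on $[0,1]$. Assume that there are constants $M,N>0$ with $M<c_1$ and $$\|k\|_\infty<\frac1{N\max_{x\in[0,1]}\int_0^1G(x,s)\,ds}$$ such that $$f(x,u_1,v_1)-f(x,u_2,v_2)\ge -M(u_1-u_2)+N(v_1-v_2)$$ whenever $x\in[0,1]$, $\alpha(x)\le u_2\le u_1\le\beta(x)$ and $\int_0^1k(x,t)\alpha(t)\,dt\le v_2\le v_1\le\int_0^1k(x,t)\beta(t)\,dt$. Put $Ly(x)=y^{(4)}(x)+My(x)-N\int_0^1k(x,t)y(t)\,dt$. Then the iterative procedure $$Ly_n(x)=f\Big(x,y_{n-1}(x),\int_0^1k(x,t)y_{n-1}(t)\,dt\Big)+My_{n-1}(x)-N\int_0^1k(x,t)y_{n-1}(t)\,dt,\quad x\in(0,1),$$ $$y_n\in C^4[0,1],\qquad y_n(0)=y_n(1)=y_n''(0)=y_n''(1)=0,\qquad n=1,2,\dots,$$ started at $y_0=\alpha$ and at $y_0=\beta$, determines unique sequences $(\alpha_n)$ and $(\beta_n)$ on $[0,1]$. They satisfy $$\alpha_{n-1}\le\alpha_n\le\beta_n\le\beta_{n-1}\quad\text{on }[0,1],\qquad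 n\ge1,$$ and converge uniformly on $[0,1]$ to solutions $\underline y$ and $\overline y$ of (1) with $\alpha\le\underline y,\overline y\le\beta$, which are respectively the minimal and the maximal solution in $[\alpha,\beta]$: every solution $y$ of (1) with $\alpha\le y\le\beta$ satisfies $\underline y\le y\le\overline y$. -/

import Mathlib

open Set Filter Topology

noncomputable section

namespace NavierIDE

/-- The functional `x ↦ ∫₀¹ k(x,t) y(t) dt`. -/
def kernelInt (k : ℝ → ℝ → ℝ) (y : ℝ → ℝ) (x : ℝ) : ℝ :=
  ∫ t in (0 : ℝ)..1, k x t * y t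

/-- The `j`-th derivative on the closed unit interval (one-sided at the end points). -/
def D (j : ℕ) (y : ℝ → ℝ) (x : ℝ) : ℝ :=
  iteratedDerivWithin j y (Icc (0 : ℝ) 1) x

/-- `y ∈ C⁴[0,1]`. -/
def IsC4 (y : ℝ → ℝ) : Prop :=
  ContDiffOn ℝ 4 y (Icc (0 : ℝ) 1)

/-- The Navier boundary condition `y(0) = y(1) = y''(0) = y''(1) = 0`. -/
def NavierBC (y : ℝ → ℝ) : Prop :=
  y 0 = 0 ∧ y 1 = 0 ∧ D 2 y 0 = 0 ∧ D 2 y 1 = 0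

/-- `y ∈ C⁴[0,1]` solves `y⁗ = f(x, y, ∫₀¹ k(x,t) y(t) dt)` in `(0,1)` with the Navier
boundary condition. -/
def IsSolution (f : ℝ → ℝ → ℝ → ℝ) (k : ℝ → ℝ → ℝ) (y : ℝ → ℝ) : Prop :=
  IsC4 y ∧ (∀ x ∈ Ioo (0 : ℝ) 1, D 4 y x = f x (y x) (kernelInt k y x)) ∧ NavierBC y

/-- Lower solution of the boundary value problem. -/
def IsLowerSolution (f : ℝ → ℝ → ℝ → ℝ) (k : ℝ → ℝ → ℝ) (a : ℝ → ℝ) : Prop :=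
  IsC4 a ∧ (∀ x ∈ Ioo (0 : ℝ) 1, D 4 a x ≤ f x (a x) (kernelInt k a x)) ∧
    a 0 ≤ 0 ∧ a 1 ≤ 0 ∧ 0 ≤ D 2 a 0 ∧ 0 ≤ D 2 a 1

/-- Upper solution of the boundary value problem. -/
def IsUpperSolution (f : ℝ → ℝ → ℝ → ℝ) (k : ℝ → ℝ → ℝ) (b : ℝ → ℝ) : Prop :=
  IsC4 b ∧ (∀ x ∈ Ioo (0 : ℝ) 1, f x (b x) (kernelInt k b x) ≤ D 4 b x) ∧
    0 ≤ b 0 ∧ 0 ≤ b 1 ∧ D 2 b 0 ≤ 0 ∧ D 2 b 1 ≤ 0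

/-- The linear operator `L y = y⁗ + M y - N ∫₀¹ k(x,t) y(t) dt`. -/
def linOp (M N : ℝ) (k : ℝ → ℝ → ℝ) (y : ℝ → ℝ) (x : ℝ) : ℝ :=
  D 4 y x + M * y x - N * kernelInt k y x

/-- `y` is produced from `z` by one step of the iteration: `y ∈ C⁴[0,1]` satisfies the Navier
boundary condition and
`L y = f(x, z, ∫₀¹ k(x,t) z(t) dt) + M z - N ∫₀¹ k(x,t) z(t) dt` in `(0,1)`. -/
def IsStep (f : ℝ → ℝ → ℝ → ℝ) (k : ℝ → ℝ → ℝ) (M N : ℝ) (z y : ℝ → ℝ) : Prop :=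
  IsC4 y ∧
    (∀ x ∈ Ioo (0 : ℝ) 1,
      linOp M N k y x = f x (z x) (kernelInt k z x) + M * z x - N * kernelInt k z x) ∧
    NavierBC y

/-- `u` is an iterative sequence with initial function `y₀`. -/
def IsIteration (f : ℝ → ℝ → ℝ → ℝ) (k : ℝ → ℝ → ℝ) (M N : ℝ) (y₀ : ℝ → ℝ)
    (u : ℕ → ℝ → ℝ) : Prop :=
  u 0 = y₀ ∧ ∀ n, IsStep f k M N (u n) (u (n + 1))

/-- `y ≤ z` on `[0,1]`. -/
def LeI (y z : ℝ → ℝ) : Prop :=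
  ∀ x ∈ Icc (0 : ℝ) 1, y x ≤ z x

/-- `κ₁ ≈ 2.36502`, the smallest positive solution of `tan κ = - tanh κ`. -/
def kappa1 : ℝ :=
  sInf {κ : ℝ | 0 < κ ∧ Real.tan κ = -Real.tanh κ}

/-- The constant `c₁ = 4 κ₁⁴ ≈ 125.14`. It is the largest `M` for which the solution `w` of
`w⁗ + M w = 0`, `w(0) = 1`, `w(1) = w''(0) = w''(1) = 0`, is nonnegative on `[0,1]`. -/
def c1 : ℝ :=
  4 * kappa1 ^ 4

/-- The infimum defining `kappa1` is attained. -/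
theorem kappa1_isLeast :
    IsLeast {κ : ℝ | 0 < κ ∧ Real.tan κ = -Real.tanh κ} kappa1 := by
  have hpi := Real.pi_pos
  have hset : {κ : ℝ | 0 < κ ∧ Real.tan κ = -Real.tanh κ} =
      Ici (Real.pi / 2) ∩
        {κ : ℝ | Real.sin κ * Real.cosh κ + Real.cos κ * Real.sinh κ = 0} := by
    ext κ
    simp only [mem_ofPred_eq, mem_inter_iff, mem_Ici]
    have hch := Real.cosh_pos κ
    constructor
    · rintro ⟨h0, h⟩
      have hsh : 0 < Real.sinh κ := Real.sinh_pos_iff.2 h0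
      have hth : 0 < Real.tanh κ := by
        rw [Real.tanh_eq_sinh_div_cosh]; positivity
      refine ⟨?_, ?_⟩
      · by_contra hlt
        have := Real.tan_pos_of_pos_of_lt_pi_div_two h0 (not_le.1 hlt)
        linarith
      · have hc : Real.cos κ ≠ 0 := by
          intro hc
          rw [Real.tan_eq_sin_div_cos, hc, div_zero] at h
          linarith
        rw [Real.tan_eq_sin_div_cos, Real.tanh_eq_sinh_div_cosh] at h
        field_simp at h
        linarith
    · rintro ⟨h0, h⟩
      have hk : 0 < κ := by linarith
      refine ⟨hk, ?_⟩
      have hc : Real.cos κ ≠ 0 := by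
        intro hc
        rw [hc, zero_mul, add_zero] at h
        rcases mul_eq_zero.1 h with hs | hs
        · have := Real.sin_sq_add_cos_sq κ
          rw [hs, hc] at this
          norm_num at this
        · exact hch.ne' hs
      rw [Real.tan_eq_sin_div_cos, Real.tanh_eq_sinh_div_cosh]
      field_simp
      linarith
  have hcont : Continuous fun κ : ℝ =>
      Real.sin κ * Real.cosh κ + Real.cos κ * Real.sinh κ := by fun_prop
  unfold kappa1
  rw [hset]
  refine IsClosed.isLeast_csInf ?_ ?_ ⟨Real.pi / 2, fun x hx => hx.1⟩
  · exact isClosed_Ici.inter (isClosed_eq hcont continuous_const)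
  · have := intermediate_value_Icc' (a := Real.pi / 2) (b := Real.pi) (by linarith)
      hcont.continuousOn
    obtain ⟨κ, hκ, h⟩ := this (show (0 : ℝ) ∈ _ from by
      refine ⟨?_, ?_⟩
      · have := Real.sinh_pos_iff.2 hpi
        simp [this.le]
      · have := Real.cosh_pos (Real.pi / 2)
        simp [this.le])
    exact ⟨κ, hκ.1, h⟩

/-- `κ` with `M = 4 κ⁴`, for `M > 0`. -/
def kap (M : ℝ) : ℝ :=
  √√(M / 4)

/-- `t ↦ sinh(κ t) cos(κ t)` with `4 κ⁴ = M`; together with `psi` a basis of the solutions of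
`y⁗ + M y = 0` with `y(0) = y''(0) = 0`. -/
def phi (M t : ℝ) : ℝ :=
  Real.sinh (kap M * t) * Real.cos (kap M * t)

/-- `t ↦ cosh(κ t) sin(κ t)` with `4 κ⁴ = M`. -/
def psi (M t : ℝ) : ℝ :=
  Real.cosh (kap M * t) * Real.sin (kap M * t)

/-- The Green function of `y⁗ + M y`, `M > 0`, with the boundary condition
`y(0) = y(1) = y''(0) = y''(1) = 0`, in closed form: `p` and `q` below are `min x s` and
`1 - max x s`. -/
def green (M x s : ℝ) : ℝ :=
  let p := min x s
  let q := 1 - max x s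
  ((phi M p * phi M q - psi M p * psi M q) * (phi M 1 + psi M 1) -
      (phi M p * psi M q + psi M p * phi M q) * (phi M 1 - psi M 1)) /
    (4 * kap M ^ 3 * (phi M 1 ^ 2 + psi M 1 ^ 2))

/-- `max_{x ∈ [0,1]} ∫₀¹ G(x,s) ds`. -/
def greenMax (M : ℝ) : ℝ :=
  sSup ((fun x => ∫ s in (0 : ℝ)..1, green M x s) '' Icc (0 : ℝ) 1)

/-- `‖k‖_∞`, the maximum of `|k|` over the unit square (for continuous `k`). -/
def supNorm (k : ℝ → ℝ → ℝ) : ℝ :=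
  sSup ((fun z : ℝ × ℝ => |k z.1 z.2|) '' (Icc (0 : ℝ) 1 ×ˢ Icc (0 : ℝ) 1))

end NavierIDE

end

noncomputable section

namespace NavierIDE

/-! Write `K y` for `kernelInt k y`. The one-sided condition on `f` says that `f(x, y, K y) + M y -
N K y` is increasing in `y` between `α` and `β`. If `L` is inverse positive
(`IsAdmissible.leI_of_linOp_le`), one step of the iteration therefore preserves order there. The
definitions of lower and upper solution give `α ≤ α₁` and `β₁ ≤ β`, and the chain of inequalities
follows by induction. A solution is a fixed point of the step, so one lying in `[α, β]` stays
between the two sequences; this gives extremality.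

Inverse positivity has two layers. For `y⁗ + M y` put `M = 4 κ⁴` and `λ = κ (1 + i)`, so `λ⁴ = -M`.
Then `z = y'' + λ² y` satisfies `z'' - λ² z = y⁗ + M y`, a second-order problem with an elementary
Green function. Its imaginary part represents `y` as a Green integral plus four boundary terms
(`IsC4.eq_integral_green`). All signs reduce to `φ = sinh · cos` and `ψ = cosh · sin`: that `φ / ψ`
decreases on `(0, π)` handles the Green function and the response to `y''`, while `|φ| ≤ ψ` up to
`κ₁` handles the response to boundary values of `y`. Only the latter uses the full strength of `M <
c1`; elsewhere `κ₁ ≤ π` is enough. The nonlocal term is absorbed because `N ‖k‖ max ∫ G < 1`, which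
excludes a negative minimum and also makes the solution operator a contraction, so each step is
solvable.

Monotone bounded sequences converge pointwise. By dominated convergence the right-hand sides
converge in `L¹`, and the bounded Green kernel turns this into uniform convergence to a solution. -/

/-! ### Hyperbolic-trigonometric inequalities and `κ₁`. -/

theorem sinh_mul_cos_le_cosh_mul_sin {t : ℝ} (h0 : 0 ≤ t) (h1 : t ≤ Real.pi) :
    Real.sinh t * Real.cos t ≤ Real.cosh t * Real.sin t := by
  have hd : ∀ x : ℝ, HasDerivAt (fun x => Real.cosh x * Real.sin x - Real.sinh x * Real.cos x)
      (2 * (Real.sinh x * Real.sin x)) x := fun x => by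
    exact (((Real.hasDerivAt_cosh x).mul (Real.hasDerivAt_sin x)).sub
      ((Real.hasDerivAt_sinh x).mul (Real.hasDerivAt_cos x))).congr_deriv (by ring)
  have hm : MonotoneOn (fun x => Real.cosh x * Real.sin x - Real.sinh x * Real.cos x)
      (Icc 0 Real.pi) := by
    refine monotoneOn_of_hasDerivWithinAt_nonneg (convex_Icc _ _)
      (fun x _ => (hd x).continuousAt.continuousWithinAt)
      (fun x _ => (hd x).hasDerivWithinAt) fun x hx => ?_
    rw [interior_Icc] at hx
    have := Real.sinh_pos_iff.2 hx.1
    have := Real.sin_pos_of_pos_of_lt_pi hx.1 hx.2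
    positivity
  have := hm ⟨le_rfl, Real.pi_pos.le⟩ ⟨h0, h1⟩ h0
  simp at this
  linarith

/-- For `a ≤ π`, fix `b` and differentiate in `a`: the derivative is at least its value `cosh b sin
b - sinh b cos b ≥ 0` at `a = b`. For `π ≤ a ≤ 2π` the left side is nonpositive. -/
theorem sinh_mul_sin_le {a b : ℝ} (hb : 0 ≤ b) (hba : b ≤ a) (hab : a + b ≤ 2 * Real.pi) :
    Real.sinh b * Real.sin a ≤ Real.sinh a * Real.sin b := by
  have hbpi : b ≤ Real.pi := by linarith
  have hsinb := Real.sin_nonneg_of_nonneg_of_le_pi hb hbpi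
  have hshb := Real.sinh_nonneg_iff.2 hb
  have hsha := Real.sinh_nonneg_iff.2 (hb.trans hba)
  rcases le_total a Real.pi with ha | ha
  · have hd : ∀ x : ℝ, HasDerivAt (fun x => Real.sinh x * Real.sin b - Real.sinh b * Real.sin x)
        (Real.cosh x * Real.sin b - Real.sinh b * Real.cos x) x := fun x =>
      ((Real.hasDerivAt_sinh x).mul_const _).sub ((Real.hasDerivAt_sin x).const_mul _)
    have hm : MonotoneOn (fun x => Real.sinh x * Real.sin b - Real.sinh b * Real.sin x)
        (Icc b Real.pi) := by
      refine monotoneOn_of_hasDerivWithinAt_nonneg (convex_Icc _ _)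
        (fun x _ => (hd x).continuousAt.continuousWithinAt)
        (fun x _ => (hd x).hasDerivWithinAt) fun x hx => ?_
      rw [interior_Icc] at hx
      have h1 : Real.cosh b ≤ Real.cosh x := by
        rw [Real.cosh_le_cosh, abs_of_nonneg hb, abs_of_nonneg (hb.trans hx.1.le)]
        exact hx.1.le
      have h2 : Real.cos x ≤ Real.cos b := Real.cos_le_cos_of_nonneg_of_le_pi hb hx.2.le hx.1.le
      have h3 := sinh_mul_cos_le_cosh_mul_sin hb hbpi
      have h4 := mul_le_mul_of_nonneg_right h1 hsinb
      have h5 := mul_le_mul_of_nonneg_left h2 hshb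
      linarith
    have := hm ⟨le_rfl, hbpi⟩ ⟨hba, ha⟩ hba
    simp only at this
    linarith
  · have : Real.sin a ≤ 0 := by
      have h := Real.sin_nonneg_of_nonneg_of_le_pi (x := a - Real.pi) (by linarith) (by linarith)
      rw [Real.sin_sub_pi] at h
      linarith
    nlinarith [mul_nonneg hsha hsinb, mul_nonneg hshb (neg_nonneg.2 this)]

/-- `sinh · cos / (cosh · sin)` is decreasing on `(0, π)`. -/
theorem cosh_mul_sin_cross_le {r s : ℝ} (hr : 0 ≤ r) (hrs : r ≤ s) (hs : s ≤ Real.pi) :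
    (Real.cosh r * Real.sin r) * (Real.sinh s * Real.cos s) ≤
      (Real.sinh r * Real.cos r) * (Real.cosh s * Real.sin s) := by
  -- The addition formulas turn this into twice the claim; the arguments sum to `2 s ≤ 2π`.
  have h := sinh_mul_sin_le (a := s + r) (b := s - r) (by linarith) (by linarith) (by linarith)
  rw [Real.sinh_sub, Real.sinh_add, Real.sin_sub, Real.sin_add] at h
  nlinarith

theorem tan_eq_neg_tanh {t : ℝ} (h : Real.cosh t * Real.sin t + Real.sinh t * Real.cos t = 0) :
    Real.tan t = -Real.tanh t := by
  have hch := Real.cosh_pos t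
  have hc : Real.cos t ≠ 0 := by
    intro hc
    rw [hc, mul_zero, add_zero] at h
    rcases mul_eq_zero.1 h with hs | hs
    · exact hch.ne' hs
    · have := Real.sin_sq_add_cos_sq t
      rw [hs, hc] at this
      norm_num at this
  rw [Real.tan_eq_sin_div_cos, Real.tanh_eq_sinh_div_cosh]
  field_simp
  linarith

/-- The expression equals `cosh (π/2) > 0` at `π/2`, so a nonpositive value at `t` forces a zero in
between. -/
theorem kappa1_le_of_nonpos {t : ℝ} (ht : Real.pi / 2 ≤ t)
    (h : Real.cosh t * Real.sin t + Real.sinh t * Real.cos t ≤ 0) : kappa1 ≤ t := by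
  have hpi := Real.pi_pos
  have hcont : Continuous fun x : ℝ => Real.cosh x * Real.sin x + Real.sinh x * Real.cos x := by
    fun_prop
  obtain ⟨x, hx, hx0⟩ := intermediate_value_Icc' ht hcont.continuousOn
    (show (0 : ℝ) ∈ _ from ⟨h, by simp [(Real.cosh_pos _).le]⟩)
  exact (kappa1_isLeast.2 ⟨by linarith [hx.1], tan_eq_neg_tanh hx0⟩).trans hx.2

theorem kappa1_le_pi : kappa1 ≤ Real.pi :=
  kappa1_le_of_nonpos (by linarith [Real.pi_pos]) (by
    simp [(Real.sinh_pos_iff.2 Real.pi_pos).le])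

theorem cosh_mul_sin_add_nonneg {t : ℝ} (h0 : 0 ≤ t) (h1 : t < kappa1) :
    0 ≤ Real.cosh t * Real.sin t + Real.sinh t * Real.cos t := by
  rcases le_total t (Real.pi / 2) with h | h
  · have h2 := Real.sin_nonneg_of_nonneg_of_le_pi h0 (by linarith [Real.pi_pos])
    have h3 := Real.cos_nonneg_of_neg_pi_div_two_le_of_le (by linarith [Real.pi_pos]) h
    have h4 := Real.sinh_nonneg_iff.2 h0
    have h5 := Real.cosh_pos t
    positivity
  · by_contra hlt
    exact absurd (kappa1_le_of_nonpos h (not_le.1 hlt).le) (not_le.2 h1)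

/-! ### Signs of `phi`, `psi` and the Green function. -/

theorem kap_pos {M : ℝ} (hM : 0 < M) : 0 < kap M := by
  unfold kap; positivity

theorem four_mul_kap_pow {M : ℝ} (hM : 0 < M) : 4 * kap M ^ 4 = M := by
  have h1 : kap M ^ 2 = √(M / 4) := Real.sq_sqrt (by positivity)
  have h2 : √(M / 4) ^ 2 = M / 4 := Real.sq_sqrt (by positivity)
  rw [show kap M ^ 4 = (kap M ^ 2) ^ 2 by ring, h1, h2]
  ring

theorem kap_lt_kappa1 {M : ℝ} (hM : 0 < M) (hMc : M < c1) : kap M < kappa1 := by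
  rw [← four_mul_kap_pow hM, c1] at hMc
  exact lt_of_pow_lt_pow_left₀ 4 kappa1_isLeast.1.1.le (by linarith)

theorem kap_mul_mem {M : ℝ} (hM : 0 < M) {t : ℝ} (ht : t ∈ Icc (0 : ℝ) 1) :
    0 ≤ kap M * t ∧ kap M * t ≤ kap M :=
  ⟨mul_nonneg (kap_pos hM).le ht.1, mul_le_of_le_one_right (kap_pos hM).le ht.2⟩

theorem psi_one_pos {M : ℝ} (hM : 0 < M) (hMc : M < c1) : 0 < psi M 1 := by
  have h := kap_pos hM
  have h2 := (kap_lt_kappa1 hM hMc).trans_le kappa1_le_pi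
  have := Real.sin_pos_of_pos_of_lt_pi h h2
  have := Real.cosh_pos (kap M)
  simp only [psi, mul_one]
  positivity

theorem abs_phi_le_psi {M : ℝ} (hM : 0 < M) (hMc : M < c1) {t : ℝ} (ht : t ∈ Icc (0 : ℝ) 1) :
    |phi M t| ≤ psi M t := by
  obtain ⟨h0, h1⟩ := kap_mul_mem hM ht
  have h2 := h1.trans_lt (kap_lt_kappa1 hM hMc)
  rw [abs_le]
  unfold phi psi
  exact ⟨by linarith [cosh_mul_sin_add_nonneg h0 h2],
    sinh_mul_cos_le_cosh_mul_sin h0 (h2.le.trans kappa1_le_pi)⟩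

theorem psi_mul_phi_one_le {M : ℝ} (hM : 0 < M) (hMc : M < c1) {t : ℝ} (ht : t ∈ Icc (0 : ℝ) 1) :
    psi M t * phi M 1 ≤ phi M t * psi M 1 := by
  obtain ⟨h0, h1⟩ := kap_mul_mem hM ht
  have h2 := ((kap_lt_kappa1 hM hMc).trans_le kappa1_le_pi).le
  simp only [phi, psi, mul_one]
  exact cosh_mul_sin_cross_le h0 h1 h2

/-- Multiply `|φ| ≤ ψ` at `t` and at `1`. This is the sign of the response to boundary values of
`y`, and the place where `κ < κ₁` is needed. -/
theorem phi_mul_phi_one_add_nonneg {M : ℝ} (hM : 0 < M) (hMc : M < c1) {t : ℝ}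
    (ht : t ∈ Icc (0 : ℝ) 1) :
    0 ≤ phi M t * phi M 1 + psi M t * psi M 1 := by
  have h1 := abs_phi_le_psi hM hMc ht
  have h2 := abs_phi_le_psi hM hMc (t := 1) (by simp)
  have h3 := mul_le_mul h1 h2 (abs_nonneg _) ((abs_nonneg _).trans h1)
  rw [← abs_mul] at h3
  linarith [neg_abs_le (phi M t * phi M 1)]

theorem green_nonneg {M : ℝ} (hM : 0 < M) (hMc : M < c1) {x s : ℝ}
    (hx : x ∈ Icc (0 : ℝ) 1) (hs : s ∈ Icc (0 : ℝ) 1) :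
    0 ≤ green M x s := by
  have hκ := kap_pos hM
  have hψ := psi_one_pos hM hMc
  set κ := kap M with hκdef
  -- With `p = min x s` and `q = 1 - max x s`, the numerator of `green` is half of `E (q + p) - E (q
  -- - p)` by the addition formulas. That `E` increases is the monotonicity of `φ / ψ`.
  let E : ℝ → ℝ := fun r => (psi M 1 - phi M 1) * (Real.sinh (κ * r) * Real.sin (κ * r)) +
    (phi M 1 + psi M 1) * (Real.cosh (κ * r) * Real.cos (κ * r))
  have hd : ∀ r, HasDerivAt E (2 * κ * (phi M r * psi M 1 - psi M r * phi M 1)) r := fun r => by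
    have hl : HasDerivAt (fun r => κ * r) κ r := by
      simpa using (hasDerivAt_id r).const_mul κ
    refine (((hl.sinh.mul hl.sin).const_mul (psi M 1 - phi M 1)).add
      ((hl.cosh.mul hl.cos).const_mul (phi M 1 + psi M 1))).congr_deriv ?_
    simp only [phi, psi, ← hκdef]
    ring
  have hm : MonotoneOn E (Icc 0 1) := by
    refine monotoneOn_of_hasDerivWithinAt_nonneg (convex_Icc _ _)
      (fun x _ => (hd x).continuousAt.continuousWithinAt)
      (fun x _ => (hd x).hasDerivWithinAt) fun r hr => ?_
    rw [interior_Icc] at hr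
    have := psi_mul_phi_one_le hM hMc ⟨hr.1.le, hr.2.le⟩
    have : 0 ≤ phi M r * psi M 1 - psi M r * phi M 1 := by linarith
    positivity
  have key : ∀ p q : ℝ, 0 ≤ p → 0 ≤ q → p + q ≤ 1 →
      0 ≤ (phi M p * phi M q - psi M p * psi M q) * (phi M 1 + psi M 1) -
        (phi M p * psi M q + psi M p * phi M q) * (phi M 1 - psi M 1) := by
    have aux : ∀ p q : ℝ, 0 ≤ p → p ≤ q → p + q ≤ 1 →
        0 ≤ (phi M p * phi M q - psi M p * psi M q) * (phi M 1 + psi M 1) -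
          (phi M p * psi M q + psi M p * phi M q) * (phi M 1 - psi M 1) := by
      intro p q hp hpq h1
      have h := hm (a := q - p) (b := q + p) ⟨by linarith, by linarith⟩
        ⟨by linarith, by linarith⟩ (by linarith)
      simp only [E, mul_sub κ, mul_add κ, Real.sinh_sub, Real.sinh_add, Real.sin_sub, Real.sin_add,
        Real.cosh_sub, Real.cosh_add, Real.cos_sub, Real.cos_add] at h
      simp only [phi, psi, ← hκdef] at h ⊢
      nlinarith
    intro p q hp hq h1
    rcases le_total p q with h | h
    · exact aux p q hp h h1
    · have := aux q p hq h (by linarith)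
      linarith
  unfold green
  refine div_nonneg (key _ _ (le_min hx.1 hs.1) (by linarith [max_le hx.2 hs.2]) ?_) (by positivity)
  linarith [min_le_max (a := x) (b := s)]

/-! ### Calculus of `D` and `IsC4` on the closed interval. -/

theorem D_zero (y : ℝ → ℝ) : D 0 y = y := by
  funext x; simp [D]

theorem IsC4.continuousOn_D {y : ℝ → ℝ} (hy : IsC4 y) {j : ℕ} (hj : j ≤ 4) :
    ContinuousOn (D j y) (Icc 0 1) :=
  hy.continuousOn_iteratedDerivWithin (by exact_mod_cast hj) (uniqueDiffOn_Icc one_pos)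

theorem IsC4.continuousOn {y : ℝ → ℝ} (hy : IsC4 y) : ContinuousOn y (Icc 0 1) :=
  ContDiffOn.continuousOn hy

theorem IsC4.hasDerivAt_D {y : ℝ → ℝ} (hy : IsC4 y) {j : ℕ} (hj : j < 4) {x : ℝ}
    (hx : x ∈ Ioo (0 : ℝ) 1) : HasDerivAt (D j y) (D (j + 1) y x) x := by
  have h := (hy.differentiableOn_iteratedDerivWithin (m := j) (by exact_mod_cast hj)
    (uniqueDiffOn_Icc one_pos) x (Ioo_subset_Icc_self hx)).hasDerivWithinAt
  rw [← iteratedDerivWithin_succ] at h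
  exact h.hasDerivAt (Icc_mem_nhds hx.1 hx.2)

theorem IsC4.sub {y z : ℝ → ℝ} (hy : IsC4 y) (hz : IsC4 z) : IsC4 (y - z) :=
  ContDiffOn.sub hy hz

theorem D_sub {y z : ℝ → ℝ} (hy : IsC4 y) (hz : IsC4 z) {j : ℕ} (hj : j ≤ 4) {x : ℝ}
    (hx : x ∈ Icc (0 : ℝ) 1) : D j (y - z) x = D j y x - D j z x :=
  iteratedDerivWithin_sub hx (uniqueDiffOn_Icc one_pos)
    ((hy x hx).of_le (by exact_mod_cast hj)) ((hz x hx).of_le (by exact_mod_cast hj))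

theorem D_succ_eqOn {y g g' : ℝ → ℝ} {j : ℕ} (h : EqOn (D j y) g (Icc 0 1))
    (hg : ∀ x, HasDerivAt g (g' x) x) : EqOn (D (j + 1) y) g' (Icc 0 1) := fun x hx => by
  rw [D, iteratedDerivWithin_succ]
  exact (((hg x).hasDerivWithinAt.congr (fun t ht => h ht) (h hx))).derivWithin
    (uniqueDiffOn_Icc one_pos x hx)

theorem isC4_of_hasDerivAt {y₀ y₁ y₂ y₃ y₄ : ℝ → ℝ} (h₀ : ∀ x, HasDerivAt y₀ (y₁ x) x)
    (h₁ : ∀ x, HasDerivAt y₁ (y₂ x) x) (h₂ : ∀ x, HasDerivAt y₂ (y₃ x) x)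
    (h₃ : ∀ x, HasDerivAt y₃ (y₄ x) x) (h₄ : Continuous y₄) :
    IsC4 y₀ ∧ EqOn (D 2 y₀) y₂ (Icc 0 1) ∧ EqOn (D 4 y₀) y₄ (Icc 0 1) := by
  have e0 : EqOn (D 0 y₀) y₀ (Icc 0 1) := fun x _ => by rw [D_zero]
  have e1 := D_succ_eqOn e0 h₀
  have e2 := D_succ_eqOn e1 h₁
  have e3 := D_succ_eqOn e2 h₂
  have e4 := D_succ_eqOn e3 h₃
  have hd : ∀ g g' : ℝ → ℝ, (∀ x, HasDerivAt g (g' x) x) → ∀ j, EqOn (D j y₀) g (Icc 0 1) →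
      DifferentiableOn ℝ (iteratedDerivWithin j y₀ (Icc 0 1)) (Icc 0 1) := fun g g' hg j hj =>
    DifferentiableOn.congr (fun x _ => (hg x).differentiableAt.differentiableWithinAt) hj
  have hlt : ∀ m : ℕ, m < 4 →
      DifferentiableOn ℝ (iteratedDerivWithin m y₀ (Icc 0 1)) (Icc 0 1) := by
    intro m hm
    interval_cases m
    exacts [hd _ _ h₀ _ e0, hd _ _ h₁ _ e1, hd _ _ h₂ _ e2, hd _ _ h₃ _ e3]
  refine ⟨?_, e2, e4⟩
  refine (contDiffOn_nat_iff_continuousOn_differentiableOn_deriv (n := 4)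
    (uniqueDiffOn_Icc one_pos)).2 ⟨fun m hm => ?_, hlt⟩
  rcases hm.lt_or_eq with h | rfl
  · exact (hlt m h).continuousOn
  · exact h₄.continuousOn.congr e4

/-! ### The complex second-order Dirichlet problem. -/

/-- The Green function of `z'' - lam² z` with Dirichlet boundary condition on `[0,1]`. -/
def greenC (lam : ℂ) (x s : ℝ) : ℂ :=
  -(Complex.sinh (lam * ↑(min x s)) * Complex.sinh (lam * ↑(1 - max x s))) /
    (lam * Complex.sinh lam)

theorem hasDerivAt_sinh_mul (lam : ℂ) (t : ℝ) :
    HasDerivAt (fun t : ℝ => Complex.sinh (lam * t)) (lam * Complex.cosh (lam * t)) t := by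
  have h := ((hasDerivAt_id (t : ℂ)).const_mul lam).csinh.comp_ofReal
  exact h.congr_deriv (by simp [mul_comm])

theorem hasDerivAt_cosh_mul (lam : ℂ) (t : ℝ) :
    HasDerivAt (fun t : ℝ => Complex.cosh (lam * t)) (lam * Complex.sinh (lam * t)) t := by
  have h := ((hasDerivAt_id (t : ℂ)).const_mul lam).ccosh.comp_ofReal
  exact h.congr_deriv (by simp [mul_comm])

theorem hasDerivAt_sinh_mul_one_sub (lam : ℂ) (t : ℝ) :
    HasDerivAt (fun t : ℝ => Complex.sinh (lam * ↑(1 - t)))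
      (-(lam * Complex.cosh (lam * ↑(1 - t)))) t := by
  have h := (hasDerivAt_sinh_mul lam (1 - t)).scomp t ((hasDerivAt_id t).const_sub 1)
  exact h.congr_deriv (by simp)

theorem hasDerivAt_cosh_mul_one_sub (lam : ℂ) (t : ℝ) :
    HasDerivAt (fun t : ℝ => Complex.cosh (lam * ↑(1 - t)))
      (-(lam * Complex.sinh (lam * ↑(1 - t)))) t := by
  have h := (hasDerivAt_cosh_mul lam (1 - t)).scomp t ((hasDerivAt_id t).const_sub 1)
  exact h.congr_deriv (by simp)

theorem integral_greenC (lam : ℂ) {h : ℝ → ℂ} (hh : ContinuousOn h (Icc 0 1)) {x : ℝ}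
    (hx : x ∈ Icc (0 : ℝ) 1) :
    ∫ s in (0 : ℝ)..1, greenC lam x s * h s =
      -(Complex.sinh (lam * ↑(1 - x)) * (∫ s in (0 : ℝ)..x, Complex.sinh (lam * s) * h s) +
        Complex.sinh (lam * x) * ∫ s in x..1, Complex.sinh (lam * ↑(1 - s)) * h s) /
        (lam * Complex.sinh lam) := by
  have hc : ContinuousOn (fun s => greenC lam x s * h s) (Icc 0 1) := by
    refine ContinuousOn.mul (Continuous.continuousOn ?_) hh
    unfold greenC
    fun_prop
  rw [← intervalIntegral.integral_add_adjacent_intervals (b := x)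
    ((hc.mono (Icc_subset_Icc_right hx.2)).intervalIntegrable_of_Icc hx.1)
    ((hc.mono (Icc_subset_Icc_left hx.1)).intervalIntegrable_of_Icc hx.2),
    intervalIntegral.integral_congr (g := fun s => (-Complex.sinh (lam * ↑(1 - x)) /
      (lam * Complex.sinh lam)) * (Complex.sinh (lam * s) * h s)),
    intervalIntegral.integral_congr (b := 1) (g := fun s => (-Complex.sinh (lam * x) /
      (lam * Complex.sinh lam)) * (Complex.sinh (lam * ↑(1 - s)) * h s)),
    intervalIntegral.integral_const_mul, intervalIntegral.integral_const_mul]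
  · ring
  · intro s hs
    rw [uIcc_of_le hx.2] at hs
    simp only [greenC, min_eq_left hs.1, max_eq_right hs.1]
    ring
  · intro s hs
    rw [uIcc_of_le hx.1] at hs
    simp only [greenC, min_eq_right hs.2, max_eq_left hs.2]
    ring

/-- Since `h = z'' - lam² z`, the products of `h` with `sinh (lam s)` and `sinh (lam (1 - s))` have
explicit antiderivatives on either side of `x`. In the combination given by the kernel `z' x`
cancels, and the addition formula for `sinh lam` leaves `z x`. -/
theorem eq_integral_greenC {lam : ℂ} (hlam : lam ≠ 0) (hsinh : Complex.sinh lam ≠ 0)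
    {z z' h : ℝ → ℂ} (hz : ContinuousOn z (Icc 0 1)) (hz' : ContinuousOn z' (Icc 0 1))
    (hh : ContinuousOn h (Icc 0 1)) (hdz : ∀ s ∈ Ioo (0 : ℝ) 1, HasDerivAt z (z' s) s)
    (hdz' : ∀ s ∈ Ioo (0 : ℝ) 1, HasDerivAt z' (lam ^ 2 * z s + h s) s) {x : ℝ}
    (hx : x ∈ Icc (0 : ℝ) 1) :
    z x = (∫ s in (0 : ℝ)..1, greenC lam x s * h s) +
      z 0 * (Complex.sinh (lam * ↑(1 - x)) / Complex.sinh lam) +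
      z 1 * (Complex.sinh (lam * x) / Complex.sinh lam) := by
  have hS : Continuous fun s : ℝ => Complex.sinh (lam * s) := by fun_prop
  have hC : Continuous fun s : ℝ => Complex.cosh (lam * s) := by fun_prop
  have hS1 : Continuous fun s : ℝ => Complex.sinh (lam * ↑(1 - s)) := by fun_prop
  have hC1 : Continuous fun s : ℝ => Complex.cosh (lam * ↑(1 - s)) := by fun_prop
  have l0 : Icc (0 : ℝ) x ⊆ Icc 0 1 := Icc_subset_Icc_right hx.2
  have l1 : Icc x (1 : ℝ) ⊆ Icc 0 1 := Icc_subset_Icc_left hx.1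
  have I1 : ∫ s in (0 : ℝ)..x, Complex.sinh (lam * s) * h s =
      (Complex.sinh (lam * x) * z' x - lam * Complex.cosh (lam * x) * z x) + lam * z 0 := by
    rw [intervalIntegral.integral_eq_sub_of_hasDerivAt_of_le hx.1
      (f := fun s => Complex.sinh (lam * s) * z' s - lam * Complex.cosh (lam * s) * z s)]
    · simp
    · exact ((hS.continuousOn.mul hz').sub
        ((continuousOn_const.mul hC.continuousOn).mul hz)).mono l0
    · intro s hs
      have hs' : s ∈ Ioo (0 : ℝ) 1 := ⟨hs.1, hs.2.trans_le hx.2⟩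
      exact (((hasDerivAt_sinh_mul lam s).mul (hdz' s hs')).sub
        (((hasDerivAt_cosh_mul lam s).const_mul lam).mul (hdz s hs'))).congr_deriv (by ring)
    · exact ((hS.continuousOn.mul hh).mono l0).intervalIntegrable_of_Icc hx.1
  have I2 : ∫ s in x..1, Complex.sinh (lam * ↑(1 - s)) * h s = lam * z 1 -
      (Complex.sinh (lam * ↑(1 - x)) * z' x + lam * Complex.cosh (lam * ↑(1 - x)) * z x) := by
    rw [intervalIntegral.integral_eq_sub_of_hasDerivAt_of_le hx.2
      (f := fun s => Complex.sinh (lam * ↑(1 - s)) * z' s +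
        lam * Complex.cosh (lam * ↑(1 - s)) * z s)]
    · simp
    · exact ((hS1.continuousOn.mul hz').add
        ((continuousOn_const.mul hC1.continuousOn).mul hz)).mono l1
    · intro s hs
      have hs' : s ∈ Ioo (0 : ℝ) 1 := ⟨hx.1.trans_lt hs.1, hs.2⟩
      exact (((hasDerivAt_sinh_mul_one_sub lam s).mul (hdz' s hs')).add
        (((hasDerivAt_cosh_mul_one_sub lam s).const_mul lam).mul (hdz s hs'))).congr_deriv
          (by ring)
    · exact ((hS1.continuousOn.mul hh).mono l1).intervalIntegrable_of_Icc hx.2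
  have hadd : Complex.sinh lam = Complex.sinh (lam * x) * Complex.cosh (lam * ↑(1 - x)) +
      Complex.cosh (lam * x) * Complex.sinh (lam * ↑(1 - x)) := by
    rw [← Complex.sinh_add]
    congr 1
    push_cast
    ring
  rw [integral_greenC lam hh hx, I1, I2]
  field_simp
  rw [hadd]
  ring

/-- Variation of constants. On differentiating the split Green integral once, the terms from the
moving limits cancel; the second time they add up to `h x` by the addition formula for `sinh lam`.
-/
theorem exists_hasDerivAt_sub_sq_mul {lam : ℂ} (hlam : lam ≠ 0) (hsinh : Complex.sinh lam ≠ 0)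
    {h : ℝ → ℂ} (hh : Continuous h) :
    ∃ z z' : ℝ → ℂ, (∀ x, HasDerivAt z (z' x) x) ∧
      (∀ x, HasDerivAt z' (lam ^ 2 * z x + h x) x) ∧ z 0 = 0 ∧ z 1 = 0 := by
  have hS : Continuous fun s : ℝ => Complex.sinh (lam * s) * h s := by fun_prop
  have hS1 : Continuous fun s : ℝ => Complex.sinh (lam * ↑(1 - s)) * h s := by fun_prop
  have d1 : ∀ x : ℝ, HasDerivAt (fun x => ∫ s in (0 : ℝ)..x, Complex.sinh (lam * s) * h s)
      (Complex.sinh (lam * x) * h x) x := fun x =>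
    intervalIntegral.integral_hasDerivAt_right (hS.intervalIntegrable _ _)
      (hS.stronglyMeasurableAtFilter _ _) hS.continuousAt
  have d2 : ∀ x : ℝ, HasDerivAt (fun x => ∫ s in x..(1 : ℝ), Complex.sinh (lam * ↑(1 - s)) * h s)
      (-(Complex.sinh (lam * ↑(1 - x)) * h x)) x := fun x =>
    intervalIntegral.integral_hasDerivAt_left (hS1.intervalIntegrable _ _)
      (hS1.stronglyMeasurableAtFilter _ _) hS1.continuousAt
  refine ⟨fun x => -(Complex.sinh (lam * ↑(1 - x)) *
        (∫ s in (0 : ℝ)..x, Complex.sinh (lam * s) * h s) +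
        Complex.sinh (lam * x) * ∫ s in x..1, Complex.sinh (lam * ↑(1 - s)) * h s) /
        (lam * Complex.sinh lam), fun x => (Complex.cosh (lam * ↑(1 - x)) *
        (∫ s in (0 : ℝ)..x, Complex.sinh (lam * s) * h s) -
        Complex.cosh (lam * x) * ∫ s in x..1, Complex.sinh (lam * ↑(1 - s)) * h s) /
        Complex.sinh lam, fun x => ?_, fun x => ?_, by simp, by simp⟩
  · refine (((((hasDerivAt_sinh_mul_one_sub lam x).mul (d1 x)).add
      ((hasDerivAt_sinh_mul lam x).mul (d2 x))).neg).div_const _).congr_deriv ?_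
    field_simp
    ring
  · refine ((((hasDerivAt_cosh_mul_one_sub lam x).mul (d1 x)).sub
      ((hasDerivAt_cosh_mul lam x).mul (d2 x))).div_const _).congr_deriv ?_
    have hadd : Complex.sinh lam = Complex.sinh (lam * x) * Complex.cosh (lam * ↑(1 - x)) +
        Complex.cosh (lam * x) * Complex.sinh (lam * ↑(1 - x)) := by
      rw [← Complex.sinh_add]
      congr 1
      push_cast
      ring
    have e : h x = (Complex.sinh (lam * x) * Complex.cosh (lam * ↑(1 - x)) +
        Complex.cosh (lam * x) * Complex.sinh (lam * ↑(1 - x))) * h x / Complex.sinh lam := by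
      rw [← hadd]
      field_simp
    conv_rhs => rw [e]
    field_simp
    ring

/-! ### Return to the real fourth-order operator. -/

/-- A square root of `2 i κ²`, hence a fourth root of `-M`, where `M = 4 κ⁴`. -/
def lam (M : ℝ) : ℂ :=
  kap M + kap M * Complex.I

theorem lam_sq (M : ℝ) : lam M ^ 2 = 2 * kap M ^ 2 * Complex.I := by
  have := Complex.I_sq
  unfold lam
  linear_combination (kap M : ℂ) ^ 2 * this

theorem sinh_lam_mul (M t : ℝ) :
    Complex.sinh (lam M * t) = phi M t + psi M t * Complex.I := by
  have : lam M * t = ↑(kap M * t) + ↑(kap M * t) * Complex.I := by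
    unfold lam; push_cast; ring
  rw [this, Complex.sinh_add, Complex.sinh_mul_I, Complex.cosh_mul_I, phi, psi]
  push_cast
  ring

theorem sinh_lam (M : ℝ) : Complex.sinh (lam M) = phi M 1 + psi M 1 * Complex.I := by
  simpa using sinh_lam_mul M 1

theorem lam_ne_zero {M : ℝ} (hM : 0 < M) : lam M ≠ 0 := fun h => by
  have := congrArg Complex.re h
  simp [lam] at this
  exact (kap_pos hM).ne' this

theorem sinh_lam_ne_zero {M : ℝ} (hM : 0 < M) (hMc : M < c1) : Complex.sinh (lam M) ≠ 0 :=
  fun h => by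
  have := congrArg Complex.im h
  simp [sinh_lam] at this
  exact (psi_one_pos hM hMc).ne' this

/-- The response of `y⁗ + M y = 0` at `t` to the boundary value `y(1) = 1`. -/
def bdryVal (M t : ℝ) : ℝ :=
  (phi M t * phi M 1 + psi M t * psi M 1) / (phi M 1 ^ 2 + psi M 1 ^ 2)

/-- The response of `y⁗ + M y = 0` at `t` to the boundary value `y''(1) = -1`. -/
def bdryDer (M t : ℝ) : ℝ :=
  (phi M t * psi M 1 - psi M t * phi M 1) / (2 * kap M ^ 2 * (phi M 1 ^ 2 + psi M 1 ^ 2))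

theorem bdryVal_nonneg {M : ℝ} (hM : 0 < M) (hMc : M < c1) {t : ℝ} (ht : t ∈ Icc (0 : ℝ) 1) :
    0 ≤ bdryVal M t :=
  div_nonneg (phi_mul_phi_one_add_nonneg hM hMc ht) (by positivity)

theorem bdryDer_nonneg {M : ℝ} (hM : 0 < M) (hMc : M < c1) {t : ℝ} (ht : t ∈ Icc (0 : ℝ) 1) :
    0 ≤ bdryDer M t :=
  div_nonneg (sub_nonneg.2 (psi_mul_phi_one_le hM hMc ht)) (by positivity)

theorem sinh_lam_mul_div {M : ℝ} (hM : 0 < M) (hMc : M < c1) (t : ℝ) :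
    Complex.sinh (lam M * t) / Complex.sinh (lam M) =
      ((bdryVal M t : ℝ) : ℂ) - ((2 * kap M ^ 2 * bdryDer M t : ℝ) : ℂ) * Complex.I := by
  have h0 := sinh_lam_ne_zero hM hMc
  have hκ := (kap_pos hM).ne'
  have h1 : phi M 1 ^ 2 + psi M 1 ^ 2 ≠ 0 := by
    have := psi_one_pos hM hMc
    positivity
  have e : 2 * kap M ^ 2 * bdryDer M t =
      (phi M t * psi M 1 - psi M t * phi M 1) / (phi M 1 ^ 2 + psi M 1 ^ 2) := by
    unfold bdryDer; field_simp
  rw [div_eq_iff h0, e, sinh_lam, sinh_lam_mul, bdryVal]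
  apply Complex.ext
  · simp [-Complex.ofReal_div]
    field_simp
    ring
  · simp [-Complex.ofReal_div]
    field_simp
    ring

theorem greenC_lam_im {M : ℝ} (hM : 0 < M) (hMc : M < c1) (x s : ℝ) :
    (greenC (lam M) x s).im = 2 * kap M ^ 2 * green M x s := by
  have hκ := (kap_pos hM).ne'
  have h1 : phi M 1 ^ 2 + psi M 1 ^ 2 ≠ 0 := by
    have := psi_one_pos hM hMc
    positivity
  have hn : Complex.normSq (lam M * Complex.sinh (lam M)) =
      2 * kap M ^ 2 * (phi M 1 ^ 2 + psi M 1 ^ 2) := by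
    rw [sinh_lam, Complex.normSq_mul, Complex.normSq_apply, Complex.normSq_apply]
    simp [lam]
    ring
  rw [greenC, Complex.div_im, hn, sinh_lam, sinh_lam_mul, sinh_lam_mul, green]
  simp only [lam, Complex.neg_re, Complex.neg_im, Complex.mul_re, Complex.mul_im, Complex.add_re,
    Complex.add_im, Complex.ofReal_re, Complex.ofReal_im, Complex.I_re, Complex.I_im]
  field_simp
  ring

theorem continuous_green (M : ℝ) : Continuous (Function.uncurry (green M)) := by
  unfold Function.uncurry green phi psi
  fun_prop

/-- The representation of a `C⁴` function through the Green function of `y⁗ + M y`. -/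
theorem IsC4.eq_integral_green {M : ℝ} (hM : 0 < M) (hMc : M < c1) {y : ℝ → ℝ} (hy : IsC4 y)
    {x : ℝ} (hx : x ∈ Icc (0 : ℝ) 1) :
    y x = (∫ s in (0 : ℝ)..1, green M x s * (D 4 y s + M * y s)) +
      y 0 * bdryVal M (1 - x) + y 1 * bdryVal M x -
      D 2 y 0 * bdryDer M (1 - x) - D 2 y 1 * bdryDer M x := by
  have hκ := kap_pos hM
  have c0 : ContinuousOn y (Icc 0 1) := hy.continuousOn
  have c1 := hy.continuousOn_D (j := 1) (by norm_num)
  have c2 := hy.continuousOn_D (j := 2) (by norm_num)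
  have c3 := hy.continuousOn_D (j := 3) (by norm_num)
  have c4 := hy.continuousOn_D (j := 4) (by norm_num)
  have co : ∀ {g : ℝ → ℝ}, ContinuousOn g (Icc 0 1) →
      ContinuousOn (fun s => (g s : ℂ)) (Icc 0 1) := fun hg =>
    Complex.continuous_ofReal.comp_continuousOn hg
  have hh := co (c4.add (c0.const_mul M))
  have hrep := eq_integral_greenC (lam_ne_zero hM) (sinh_lam_ne_zero hM hMc)
    -- This is `y'' + λ² y`, whose imaginary part is `2 κ² y`; `λ⁴ = -M` makes the forcing term `y⁗
    -- + M y`.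
    (z := fun s => (D 2 y s : ℂ) + 2 * kap M ^ 2 * Complex.I * y s)
    (z' := fun s => (D 3 y s : ℂ) + 2 * kap M ^ 2 * Complex.I * D 1 y s)
    ((co c2).add ((co c0).const_mul _)) ((co c3).add ((co c1).const_mul _)) hh
    (fun s hs => by
      have h0 := hy.hasDerivAt_D (j := 0) (by norm_num) hs
      rw [D_zero] at h0
      exact (hy.hasDerivAt_D (j := 2) (by norm_num) hs).ofReal_comp.add
        (h0.ofReal_comp.const_mul _))
    (fun s hs => by
      refine ((hy.hasDerivAt_D (j := 3) (by norm_num) hs).ofReal_comp.add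
        ((hy.hasDerivAt_D (j := 1) (by norm_num) hs).ofReal_comp.const_mul _)).congr_deriv ?_
      have hM4 : (M : ℂ) = 4 * (kap M : ℂ) ^ 4 := by
        exact_mod_cast (four_mul_kap_pow hM).symm
      rw [lam_sq]
      simp only [Pi.add_apply, Complex.ofReal_add, Complex.ofReal_mul, hM4]
      linear_combination (-4 * (kap M : ℂ) ^ 4 * y s) * Complex.I_sq) hx
  have hint : (∫ s in (0 : ℝ)..1, greenC (lam M) x s * ↑((D 4 y + fun s => M * y s) s)).im =
      2 * kap M ^ 2 * ∫ s in (0 : ℝ)..1, green M x s * (D 4 y s + M * y s) := by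
    have hg : Continuous fun s => greenC (lam M) x s := by
      unfold greenC; fun_prop
    have := Complex.imCLM.intervalIntegral_comp_comm
      ((hg.continuousOn.mul hh).intervalIntegrable_of_Icc (μ := MeasureTheory.volume) zero_le_one)
    simp only [Complex.imCLM_apply, Pi.mul_apply] at this
    rw [← this, ← intervalIntegral.integral_const_mul]
    refine intervalIntegral.integral_congr fun s _ => ?_
    simp only [Complex.im_mul_ofReal, greenC_lam_im hM hMc, Pi.add_apply]
    ring
  have him := congrArg Complex.im hrep
  rw [sinh_lam_mul_div hM hMc, sinh_lam_mul_div hM hMc] at him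
  simp only [Complex.add_im, hint] at him
  simp [-Complex.ofReal_mul, -Complex.ofReal_pow] at him
  norm_cast at him
  have h2 : 2 * kap M ^ 2 ≠ 0 := by positivity
  apply mul_left_cancel₀ h2
  linear_combination him

/-- The reduction run backwards: `y = Im z / (2 κ²)` has `y'' = Re z` because the forcing is real,
so the Dirichlet condition on `z` is the Navier condition on `y`. -/
theorem exists_isC4_navierBC {M : ℝ} (hM : 0 < M) (hMc : M < c1) {h : ℝ → ℝ}
    (hh : Continuous h) :
    ∃ y, IsC4 y ∧ NavierBC y ∧ ∀ x ∈ Icc (0 : ℝ) 1, D 4 y x + M * y x = h x := by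
  have hκ := kap_pos hM
  obtain ⟨z, z', hz, hz', z0, z1⟩ := exists_hasDerivAt_sub_sq_mul (lam_ne_zero hM)
    (sinh_lam_ne_zero hM hMc) (h := fun x => (h x : ℂ)) (Complex.continuous_ofReal.comp hh)
  have him : ∀ {g : ℝ → ℂ} {g' : ℂ} {x : ℝ}, HasDerivAt g g' x →
      HasDerivAt (fun x => (g x).im) g'.im x := fun hg =>
    Complex.imCLM.hasFDerivAt.comp_hasDerivAt _ hg
  have hre : ∀ {g : ℝ → ℂ} {g' : ℂ} {x : ℝ}, HasDerivAt g g' x →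
      HasDerivAt (fun x => (g x).re) g'.re x := fun hg =>
    Complex.reCLM.hasFDerivAt.comp_hasDerivAt _ hg
  have hzc : Continuous z := continuous_iff_continuousAt.2 fun x => (hz x).continuousAt
  obtain ⟨h4, hd2, hd4⟩ := isC4_of_hasDerivAt (y₀ := fun x => (z x).im / (2 * kap M ^ 2))
    (y₁ := fun x => (z' x).im / (2 * kap M ^ 2)) (y₂ := fun x => (z x).re)
    (y₃ := fun x => (z' x).re) (y₄ := fun x => -(2 * kap M ^ 2) * (z x).im + h x)
    (fun x => (him (hz x)).div_const _)
    (fun x => ((him (hz' x)).div_const _).congr_deriv (by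
      rw [lam_sq]
      norm_cast
      simp [-Complex.ofReal_mul, -Complex.ofReal_pow]
      field_simp))
    (fun x => hre (hz x))
    (fun x => (hre (hz' x)).congr_deriv (by
      rw [lam_sq]
      norm_cast
      simp [-Complex.ofReal_mul, -Complex.ofReal_pow]))
    (by fun_prop)
  refine ⟨_, h4, ⟨by simp [z0], by simp [z1], ?_, ?_⟩, fun x hx => ?_⟩
  · rw [hd2 (by simp)]; simp [z0]
  · rw [hd2 (by simp)]; simp [z1]
  · rw [hd4 hx]
    have := four_mul_kap_pow hM
    nth_rewrite 2 [← this]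
    field_simp
    ring

/-! ### Extension from `[0,1]` and the kernel operator. -/

/-- The nearest point of `[0,1]`. -/
def clamp (x : ℝ) : ℝ :=
  projIcc (0 : ℝ) 1 zero_le_one x

theorem continuous_clamp : Continuous clamp :=
  continuous_subtype_val.comp continuous_projIcc

theorem clamp_mem (x : ℝ) : clamp x ∈ Icc (0 : ℝ) 1 :=
  (projIcc (0 : ℝ) 1 zero_le_one x).2

theorem clamp_of_mem {x : ℝ} (hx : x ∈ Icc (0 : ℝ) 1) : clamp x = x := by
  rw [clamp, projIcc_of_mem zero_le_one hx]

theorem continuous_comp_clamp {g : ℝ → ℝ} (hg : ContinuousOn g (Icc 0 1)) :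
    Continuous fun x => g (clamp x) :=
  hg.comp_continuous continuous_clamp clamp_mem

section Kernel

variable {k : ℝ → ℝ → ℝ}

theorem continuousOn_kernel_right
    (hk : ContinuousOn (fun z : ℝ × ℝ => k z.1 z.2) (Icc (0 : ℝ) 1 ×ˢ Icc (0 : ℝ) 1)) {x : ℝ}
    (hx : x ∈ Icc (0 : ℝ) 1) : ContinuousOn (k x) (Icc 0 1) :=
  hk.comp (f := fun t => (x, t)) (by fun_prop) fun _ ht => ⟨hx, ht⟩

theorem intervalIntegrable_kernel_mul
    (hk : ContinuousOn (fun z : ℝ × ℝ => k z.1 z.2) (Icc (0 : ℝ) 1 ×ˢ Icc (0 : ℝ) 1)) {x : ℝ}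
    (hx : x ∈ Icc (0 : ℝ) 1) {y : ℝ → ℝ} (hy : ContinuousOn y (Icc 0 1)) :
    IntervalIntegrable (fun t => k x t * y t) MeasureTheory.volume 0 1 :=
  ((continuousOn_kernel_right hk hx).mul hy).intervalIntegrable_of_Icc zero_le_one

theorem kernelInt_congr {y z : ℝ → ℝ} (h : EqOn y z (Icc 0 1)) (x : ℝ) :
    kernelInt k y x = kernelInt k z x :=
  intervalIntegral.integral_congr fun t ht => by
    rw [uIcc_of_le zero_le_one] at ht
    simp only [h ht]

theorem continuousOn_kernelInt
    (hk : ContinuousOn (fun z : ℝ × ℝ => k z.1 z.2) (Icc (0 : ℝ) 1 ×ˢ Icc (0 : ℝ) 1))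
    {y : ℝ → ℝ} (hy : ContinuousOn y (Icc 0 1)) : ContinuousOn (kernelInt k y) (Icc 0 1) := by
  have hc : Continuous (Function.uncurry fun x t => k (clamp x) (clamp t) * y (clamp t)) := by
    refine Continuous.mul ?_ ((continuous_comp_clamp hy).comp continuous_snd)
    exact hk.comp_continuous (f := fun z : ℝ × ℝ => (clamp z.1, clamp z.2))
      ((continuous_clamp.comp continuous_fst).prodMk (continuous_clamp.comp continuous_snd))
      fun z => ⟨clamp_mem _, clamp_mem _⟩
  refine (intervalIntegral.continuous_parametric_intervalIntegral_of_continuous'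
    (μ := MeasureTheory.volume) hc 0 1).continuousOn.congr fun x hx => ?_
  refine intervalIntegral.integral_congr fun t ht => ?_
  rw [uIcc_of_le zero_le_one] at ht
  simp only [clamp_of_mem hx, clamp_of_mem ht]

theorem kernelInt_sub
    (hk : ContinuousOn (fun z : ℝ × ℝ => k z.1 z.2) (Icc (0 : ℝ) 1 ×ˢ Icc (0 : ℝ) 1))
    {y z : ℝ → ℝ} (hy : ContinuousOn y (Icc 0 1)) (hz : ContinuousOn z (Icc 0 1)) {x : ℝ}
    (hx : x ∈ Icc (0 : ℝ) 1) : kernelInt k (y - z) x = kernelInt k y x - kernelInt k z x := by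
  rw [kernelInt, kernelInt, kernelInt, ← intervalIntegral.integral_sub
    (intervalIntegrable_kernel_mul hk hx hy) (intervalIntegrable_kernel_mul hk hx hz)]
  simp only [Pi.sub_apply, mul_sub]

theorem kernelInt_mono
    (hk : ContinuousOn (fun z : ℝ × ℝ => k z.1 z.2) (Icc (0 : ℝ) 1 ×ˢ Icc (0 : ℝ) 1))
    (hk0 : ∀ x ∈ Icc (0 : ℝ) 1, ∀ t ∈ Icc (0 : ℝ) 1, 0 ≤ k x t)
    {y z : ℝ → ℝ} (hy : ContinuousOn y (Icc 0 1)) (hz : ContinuousOn z (Icc 0 1))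
    (h : LeI y z) : LeI (kernelInt k y) (kernelInt k z) := fun x hx =>
  intervalIntegral.integral_mono_on zero_le_one (intervalIntegrable_kernel_mul hk hx hy)
    (intervalIntegrable_kernel_mul hk hx hz) fun t ht =>
      mul_le_mul_of_nonneg_left (h t ht) (hk0 x hx t ht)

theorem abs_kernel_le_supNorm
    (hk : ContinuousOn (fun z : ℝ × ℝ => k z.1 z.2) (Icc (0 : ℝ) 1 ×ˢ Icc (0 : ℝ) 1)) {x t : ℝ}
    (hx : x ∈ Icc (0 : ℝ) 1) (ht : t ∈ Icc (0 : ℝ) 1) : |k x t| ≤ supNorm k :=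
  le_csSup ((isCompact_Icc.prod isCompact_Icc).bddAbove_image hk.abs) ⟨(x, t), ⟨hx, ht⟩, rfl⟩

theorem supNorm_nonneg
    (hk : ContinuousOn (fun z : ℝ × ℝ => k z.1 z.2) (Icc (0 : ℝ) 1 ×ˢ Icc (0 : ℝ) 1)) :
    0 ≤ supNorm k :=
  (abs_nonneg _).trans (abs_kernel_le_supNorm hk (x := 0) (t := 0) (by simp) (by simp))

/-- Pointwise `‖k‖ m ≤ k m ≤ k y`, the first inequality because `m ≤ 0`. -/
theorem le_kernelInt
    (hk : ContinuousOn (fun z : ℝ × ℝ => k z.1 z.2) (Icc (0 : ℝ) 1 ×ˢ Icc (0 : ℝ) 1))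
    (hk0 : ∀ x ∈ Icc (0 : ℝ) 1, ∀ t ∈ Icc (0 : ℝ) 1, 0 ≤ k x t)
    {y : ℝ → ℝ} (hy : ContinuousOn y (Icc 0 1)) {m : ℝ} (hm : m ≤ 0)
    (h : ∀ t ∈ Icc (0 : ℝ) 1, m ≤ y t) {x : ℝ} (hx : x ∈ Icc (0 : ℝ) 1) :
    supNorm k * m ≤ kernelInt k y x := by
  have := intervalIntegral.integral_mono_on zero_le_one
    (intervalIntegrable_const (c := supNorm k * m) (μ := MeasureTheory.volume))
    (intervalIntegrable_kernel_mul hk hx hy) fun t ht =>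
      (mul_le_mul_of_nonpos_right ((le_abs_self _).trans (abs_kernel_le_supNorm hk hx ht)) hm).trans
        (mul_le_mul_of_nonneg_left (h t ht) (hk0 x hx t ht))
  simpa [kernelInt] using this

theorem abs_kernelInt_le
    (hk : ContinuousOn (fun z : ℝ × ℝ => k z.1 z.2) (Icc (0 : ℝ) 1 ×ˢ Icc (0 : ℝ) 1))
    {y : ℝ → ℝ} {B : ℝ} (h : ∀ t ∈ Icc (0 : ℝ) 1, |y t| ≤ B) {x : ℝ} (hx : x ∈ Icc (0 : ℝ) 1) :
    |kernelInt k y x| ≤ supNorm k * B := by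
  have := intervalIntegral.norm_integral_le_of_norm_le_const (a := 0) (b := 1)
    (f := fun t => k x t * y t) (C := supNorm k * B) fun t ht => by
      rw [uIoc_of_le zero_le_one] at ht
      have ht' := Ioc_subset_Icc_self ht
      rw [norm_mul]
      exact mul_le_mul (abs_kernel_le_supNorm hk hx ht') (h t ht') (norm_nonneg _)
        (supNorm_nonneg hk)
  simpa [kernelInt] using this

end Kernel

/-! ### Green integrals, and inverse positivity and solvability for `linOp`. -/

theorem continuous_integral_green_mul (M : ℝ) {g : ℝ → ℝ} (hg : Continuous g) :
    Continuous fun x => ∫ s in (0 : ℝ)..1, green M x s * g s :=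
  intervalIntegral.continuous_parametric_intervalIntegral_of_continuous'
    ((continuous_green M).mul (hg.comp continuous_snd)) 0 1

theorem continuous_green_right (M x : ℝ) : Continuous (green M x) :=
  (continuous_green M).comp (f := fun s => (x, s)) (by fun_prop)

theorem integral_green_le_greenMax (M : ℝ) {x : ℝ} (hx : x ∈ Icc (0 : ℝ) 1) :
    ∫ s in (0 : ℝ)..1, green M x s ≤ greenMax M := by
  have hc := continuous_integral_green_mul M (g := fun _ => 1) continuous_const
  simp only [mul_one] at hc
  exact le_csSup (isCompact_Icc.bddAbove_image hc.continuousOn) ⟨x, hx, rfl⟩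

/-- The standing hypotheses on the linear operator `linOp M N k`. -/
structure IsAdmissible (M N : ℝ) (k : ℝ → ℝ → ℝ) : Prop where
  pos : 0 < M
  lt_c1 : M < c1
  nonneg : 0 ≤ N
  continuousOn : ContinuousOn (fun z : ℝ × ℝ => k z.1 z.2) (Icc (0 : ℝ) 1 ×ˢ Icc (0 : ℝ) 1)
  kernel_nonneg : ∀ x ∈ Icc (0 : ℝ) 1, ∀ t ∈ Icc (0 : ℝ) 1, 0 ≤ k x t
  lt_one : N * supNorm k * greenMax M < 1

theorem integral_green_nonneg {M : ℝ} (hM : 0 < M) (hMc : M < c1) {x : ℝ}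
    (hx : x ∈ Icc (0 : ℝ) 1) : 0 ≤ ∫ s in (0 : ℝ)..1, green M x s :=
  intervalIntegral.integral_nonneg zero_le_one fun _ hs => green_nonneg hM hMc hx hs

theorem greenMax_nonneg {M : ℝ} (hM : 0 < M) (hMc : M < c1) : 0 ≤ greenMax M :=
  (integral_green_nonneg hM hMc (x := 0) (by simp)).trans (integral_green_le_greenMax M (by simp))

namespace IsAdmissible

variable {M N : ℝ} {k : ℝ → ℝ → ℝ}

/-- At a negative minimum `m = y ξ` the boundary terms are nonnegative and `y⁗ + M y ≥ N K y ≥ N ‖k‖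
m`. The representation then gives `m ≥ N ‖k‖ (max ∫ G) m > m`. -/
theorem nonneg_of_linOp_nonneg (A : IsAdmissible M N k) {y : ℝ → ℝ} (hy : IsC4 y)
    (hL : ∀ x ∈ Ioo (0 : ℝ) 1, 0 ≤ linOp M N k y x) (h0 : 0 ≤ y 0) (h1 : 0 ≤ y 1)
    (h0' : D 2 y 0 ≤ 0) (h1' : D 2 y 1 ≤ 0) {x : ℝ} (hx : x ∈ Icc (0 : ℝ) 1) : 0 ≤ y x := by
  obtain ⟨ξ, hξ, hmin⟩ := isCompact_Icc.exists_isMinOn (nonempty_Icc.2 zero_le_one)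
    hy.continuousOn
  refine le_trans ?_ (hmin hx)
  by_contra hneg
  rw [not_le] at hneg
  set m := y ξ with hm
  have hN := A.nonneg
  have hs := supNorm_nonneg A.continuousOn
  have hξ' : 1 - ξ ∈ Icc (0 : ℝ) 1 := ⟨by linarith [hξ.2], by linarith [hξ.1]⟩
  have hrep := hy.eq_integral_green A.pos A.lt_c1 hξ
  have b1 := mul_nonneg h0 (bdryVal_nonneg A.pos A.lt_c1 hξ')
  have b2 := mul_nonneg h1 (bdryVal_nonneg A.pos A.lt_c1 hξ)
  have b3 := mul_nonpos_of_nonpos_of_nonneg h0' (bdryDer_nonneg A.pos A.lt_c1 hξ')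
  have b4 := mul_nonpos_of_nonpos_of_nonneg h1' (bdryDer_nonneg A.pos A.lt_c1 hξ)
  have hint : ∫ s in (0 : ℝ)..1, green M ξ s * (N * (supNorm k * m)) ≤
      ∫ s in (0 : ℝ)..1, green M ξ s * (D 4 y s + M * y s) := by
    refine intervalIntegral.integral_mono_on_of_le_Ioo zero_le_one
      (((continuous_green_right M ξ).mul continuous_const).intervalIntegrable _ _)
      (((continuous_green_right M ξ).continuousOn.mul ((hy.continuousOn_D le_rfl).add
        (continuousOn_const.mul hy.continuousOn))).intervalIntegrable_of_Icc zero_le_one)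
      fun s hs => mul_le_mul_of_nonneg_left ?_
        (green_nonneg A.pos A.lt_c1 hξ (Ioo_subset_Icc_self hs))
    have h := hL s hs
    have h' := mul_le_mul_of_nonneg_left (le_kernelInt A.continuousOn A.kernel_nonneg
      hy.continuousOn hneg.le (fun t ht => hmin ht) (Ioo_subset_Icc_self hs)) hN
    unfold linOp at h
    linarith
  rw [intervalIntegral.integral_mul_const] at hint
  have h2 := mul_le_mul_of_nonpos_right (integral_green_le_greenMax M hξ)
    (mul_nonpos_of_nonneg_of_nonpos hN (mul_nonpos_of_nonneg_of_nonpos hs hneg.le))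
  have h3 := mul_pos_of_neg_of_neg (sub_neg.2 A.lt_one) hneg
  rw [← hm] at hrep
  linarith

theorem leI_of_linOp_le (A : IsAdmissible M N k) {y z : ℝ → ℝ} (hy : IsC4 y) (hz : IsC4 z)
    (hL : ∀ x ∈ Ioo (0 : ℝ) 1, linOp M N k y x ≤ linOp M N k z x) (h0 : y 0 ≤ z 0)
    (h1 : y 1 ≤ z 1) (h0' : D 2 z 0 ≤ D 2 y 0) (h1' : D 2 z 1 ≤ D 2 y 1) : LeI y z := by
  have hm0 : (0 : ℝ) ∈ Icc (0 : ℝ) 1 := by simp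
  have hm1 : (1 : ℝ) ∈ Icc (0 : ℝ) 1 := by simp
  intro x hx
  have := A.nonneg_of_linOp_nonneg (hz.sub hy) (fun s hs => ?_) (sub_nonneg.2 h0)
    (sub_nonneg.2 h1) (by rw [D_sub hz hy (by norm_num) hm0]; linarith)
    (by rw [D_sub hz hy (by norm_num) hm1]; linarith) hx
  · simpa using this
  · have hs' := Ioo_subset_Icc_self hs
    have h := hL s hs
    rw [linOp, D_sub hz hy le_rfl hs', kernelInt_sub A.continuousOn hz.continuousOn
      hy.continuousOn hs', Pi.sub_apply]
    unfold linOp at h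
    linarith

/-- Banach's fixed point theorem for `u ↦ ∫ G (h + N K u)` on `C[0,1]`, with the contraction
constant supplied by `lt_one`. -/
theorem exists_linOp_eq (A : IsAdmissible M N k) {h : ℝ → ℝ} (hh : ContinuousOn h (Icc 0 1)) :
    ∃ y, IsC4 y ∧ NavierBC y ∧ ∀ x ∈ Icc (0 : ℝ) 1, linOp M N k y x = h x := by
  let e : C(Icc (0 : ℝ) 1, ℝ) → ℝ → ℝ := fun u x => u (projIcc 0 1 zero_le_one x)
  have he : ∀ u, Continuous (e u) := fun u => u.continuous.comp continuous_projIcc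
  let q : C(Icc (0 : ℝ) 1, ℝ) → ℝ → ℝ := fun u s =>
    h (clamp s) + N * kernelInt k (e u) (clamp s)
  have hq : ∀ u, Continuous (q u) := fun u => (continuous_comp_clamp hh).add
    (continuous_const.mul
      (continuous_comp_clamp (continuousOn_kernelInt A.continuousOn (he u).continuousOn)))
  let T : C(Icc (0 : ℝ) 1, ℝ) → C(Icc (0 : ℝ) 1, ℝ) := fun u =>
    ⟨fun x => ∫ s in (0 : ℝ)..1, green M x s * q u s,
      (continuous_integral_green_mul M (hq u)).comp continuous_subtype_val⟩
  have hN := A.nonneg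
  have hs := supNorm_nonneg A.continuousOn
  have hg := greenMax_nonneg A.pos A.lt_c1
  have hθ : 0 ≤ N * supNorm k * greenMax M := by positivity
  have hT : ContractingWith (N * supNorm k * greenMax M).toNNReal T := by
    refine ⟨Real.toNNReal_lt_one.2 A.lt_one, LipschitzWith.of_dist_le_mul fun u v => ?_⟩
    rw [Real.coe_toNNReal _ hθ]
    rw [ContinuousMap.dist_le (mul_nonneg hθ dist_nonneg)]
    intro x
    have hd : ∀ s, |q u s - q v s| ≤ N * (supNorm k * dist u v) := fun s => by
      have h1 : q u s - q v s = N * kernelInt k (e u - e v) (clamp s) := by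
        rw [kernelInt_sub A.continuousOn (he u).continuousOn (he v).continuousOn (clamp_mem s)]
        simp only [q]
        ring
      rw [h1, abs_mul, abs_of_nonneg hN]
      refine mul_le_mul_of_nonneg_left (abs_kernelInt_le A.continuousOn (fun t _ => ?_)
        (clamp_mem s)) hN
      exact ContinuousMap.dist_apply_le_dist (f := u) (g := v) _
    have hi : ∀ w, IntervalIntegrable (fun s => green M x s * q w s) MeasureTheory.volume 0 1 :=
      fun w => ((continuous_green_right M x).mul (hq w)).intervalIntegrable _ _
    have hle : ‖∫ s in (0 : ℝ)..1, (green M x s * q u s - green M x s * q v s)‖ ≤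
        ∫ s in (0 : ℝ)..1, green M x s * (N * (supNorm k * dist u v)) := by
      refine intervalIntegral.norm_integral_le_of_norm_le zero_le_one
        (Eventually.of_forall fun s hs' => ?_)
        (((continuous_green_right M x).mul continuous_const).intervalIntegrable _ _)
      have hg0 := green_nonneg A.pos A.lt_c1 x.2 (Ioc_subset_Icc_self hs')
      rw [← mul_sub, norm_mul, Real.norm_of_nonneg hg0]
      exact mul_le_mul_of_nonneg_left (hd s) hg0
    rw [intervalIntegral.integral_sub (hi u) (hi v), intervalIntegral.integral_mul_const] at hle
    refine hle.trans ((mul_le_mul_of_nonneg_right (integral_green_le_greenMax M x.2)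
      (by positivity)).trans_eq ?_)
    ring
  set u := hT.fixedPoint T
  have hu : T u = u := hT.fixedPoint_isFixedPt
  -- The fixed point is only known to be continuous. Solving the local problem with forcing `q u`
  -- gives a `C⁴` function with the same Green integral, hence equal to it on `[0,1]`.
  obtain ⟨y, hy, hbc, hode⟩ := exists_isC4_navierBC A.pos A.lt_c1 (hq u)
  have hyu : EqOn y (e u) (Icc 0 1) := fun x hx => by
    rw [hy.eq_integral_green A.pos A.lt_c1 hx, hbc.1, hbc.2.1, hbc.2.2.1, hbc.2.2.2]
    simp only [zero_mul, add_zero, sub_zero]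
    have h1 : e u x = T u ⟨x, hx⟩ := by
      rw [hu]; simp only [e, projIcc_of_mem zero_le_one hx]
    rw [h1]
    refine intervalIntegral.integral_congr fun s hs => ?_
    rw [uIcc_of_le zero_le_one] at hs
    simp only [hode s hs]
  refine ⟨y, hy, hbc, fun x hx => ?_⟩
  rw [linOp, hode x hx, kernelInt_congr hyu]
  simp only [q, clamp_of_mem hx]
  ring

end IsAdmissible

/-! ### The nonlinearity and the iteration. -/

section Nonlinearity

variable {f : ℝ → ℝ → ℝ → ℝ}

theorem continuousOn_comp_kernelInt {k : ℝ → ℝ → ℝ}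
    (hf : ContinuousOn (fun z : ℝ × ℝ × ℝ => f z.1 z.2.1 z.2.2)
      (Icc (0 : ℝ) 1 ×ˢ (univ : Set (ℝ × ℝ))))
    (hk : ContinuousOn (fun z : ℝ × ℝ => k z.1 z.2) (Icc (0 : ℝ) 1 ×ˢ Icc (0 : ℝ) 1))
    {y : ℝ → ℝ} (hy : ContinuousOn y (Icc 0 1)) :
    ContinuousOn (fun x => f x (y x) (kernelInt k y x)) (Icc 0 1) :=
  hf.comp (f := fun x => (x, y x, kernelInt k y x))
    (continuousOn_id.prodMk (hy.prodMk (continuousOn_kernelInt hk hy))) fun _ hx => ⟨hx, mem_univ _⟩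

theorem continuous_nonlinearity_right
    (hf : ContinuousOn (fun z : ℝ × ℝ × ℝ => f z.1 z.2.1 z.2.2)
      (Icc (0 : ℝ) 1 ×ˢ (univ : Set (ℝ × ℝ)))) {x : ℝ} (hx : x ∈ Icc (0 : ℝ) 1) :
    Continuous fun p : ℝ × ℝ => f x p.1 p.2 :=
  hf.comp_continuous (f := fun p : ℝ × ℝ => (x, p)) (by fun_prop) fun _ => ⟨hx, mem_univ _⟩

theorem exists_bound_nonlinearity
    (hf : ContinuousOn (fun z : ℝ × ℝ × ℝ => f z.1 z.2.1 z.2.2)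
      (Icc (0 : ℝ) 1 ×ˢ (univ : Set (ℝ × ℝ)))) (B B' : ℝ) :
    ∃ C, ∀ x ∈ Icc (0 : ℝ) 1, ∀ u v : ℝ, |u| ≤ B → |v| ≤ B' → |f x u v| ≤ C := by
  obtain ⟨C, hC⟩ := ((isCompact_Icc (a := (0 : ℝ)) (b := 1)).prod
    ((isCompact_Icc (a := -B) (b := B)).prod (isCompact_Icc (a := -B') (b := B')))
    ).exists_bound_of_continuousOn (hf.mono (prod_mono_right (subset_univ _)))
  exact ⟨C, fun x hx u v hu hv => hC (x, u, v) ⟨hx, abs_le.1 hu, abs_le.1 hv⟩⟩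

end Nonlinearity

namespace IsAdmissible

variable {M N : ℝ} {k : ℝ → ℝ → ℝ} {f : ℝ → ℝ → ℝ → ℝ}

theorem exists_isStep (A : IsAdmissible M N k)
    (hf : ContinuousOn (fun z : ℝ × ℝ × ℝ => f z.1 z.2.1 z.2.2)
      (Icc (0 : ℝ) 1 ×ˢ (univ : Set (ℝ × ℝ)))) {z : ℝ → ℝ} (hz : ContinuousOn z (Icc 0 1)) :
    ∃ y, IsStep f k M N z y := by
  obtain ⟨y, hy, hbc, hode⟩ := A.exists_linOp_eq
    (((continuousOn_comp_kernelInt hf A.continuousOn hz).add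
      (continuousOn_const (c := M).mul hz)).sub
      (continuousOn_const (c := N).mul (continuousOn_kernelInt A.continuousOn hz)))
  exact ⟨y, hy, fun x hx => hode x (Ioo_subset_Icc_self hx), hbc⟩

/-- Each step lands in `C⁴`, so a choice of solutions is a self-map of the subtype of `C⁴` functions
and can be iterated. -/
theorem exists_isIteration (A : IsAdmissible M N k)
    (hf : ContinuousOn (fun z : ℝ × ℝ × ℝ => f z.1 z.2.1 z.2.2)
      (Icc (0 : ℝ) 1 ×ˢ (univ : Set (ℝ × ℝ)))) {y₀ : ℝ → ℝ} (hy₀ : IsC4 y₀) :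
    ∃ u, IsIteration f k M N y₀ u := by
  have h : ∀ z : {z : ℝ → ℝ // IsC4 z}, ∃ y : {z : ℝ → ℝ // IsC4 z}, IsStep f k M N z y := fun z =>
    let ⟨y, hy⟩ := A.exists_isStep hf z.2.continuousOn
    ⟨⟨y, hy.1⟩, hy⟩
  choose S hS using h
  refine ⟨fun n => (S^[n] ⟨y₀, hy₀⟩ : {z : ℝ → ℝ // IsC4 z}), rfl, fun n => ?_⟩
  simp only [Function.iterate_succ_apply']
  exact hS _

theorem isStep_mono (A : IsAdmissible M N k) {z₁ z₂ y₁ y₂ : ℝ → ℝ} (h₁ : IsStep f k M N z₁ y₁)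
    (h₂ : IsStep f k M N z₂ y₂)
    (h : ∀ x ∈ Icc (0 : ℝ) 1, f x (z₁ x) (kernelInt k z₁ x) + M * z₁ x - N * kernelInt k z₁ x ≤
      f x (z₂ x) (kernelInt k z₂ x) + M * z₂ x - N * kernelInt k z₂ x) : LeI y₁ y₂ := by
  obtain ⟨a0, a1, a2, a3⟩ := h₁.2.2
  obtain ⟨b0, b1, b2, b3⟩ := h₂.2.2
  refine A.leI_of_linOp_le h₁.1 h₂.1 (fun x hx => ?_) (by rw [a0, b0]) (by rw [a1, b1])
    (by rw [a2, b2]) (by rw [a3, b3])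
  rw [h₁.2.1 x hx, h₂.2.1 x hx]
  exact h x (Ioo_subset_Icc_self hx)

theorem isStep_unique (A : IsAdmissible M N k) {z₁ z₂ y₁ y₂ : ℝ → ℝ} (h₁ : IsStep f k M N z₁ y₁)
    (h₂ : IsStep f k M N z₂ y₂) (h : EqOn z₁ z₂ (Icc 0 1)) : EqOn y₁ y₂ (Icc 0 1) := fun x hx =>
  le_antisymm
    (A.isStep_mono h₁ h₂ (fun t ht => by rw [kernelInt_congr h, h ht]) x hx)
    (A.isStep_mono h₂ h₁ (fun t ht => by rw [kernelInt_congr h, h ht]) x hx)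

theorem isIteration_unique (A : IsAdmissible M N k) {y₀ : ℝ → ℝ} {u v : ℕ → ℝ → ℝ}
    (hu : IsIteration f k M N y₀ u) (hv : IsIteration f k M N y₀ v) (n : ℕ) :
    EqOn (u n) (v n) (Icc 0 1) := by
  induction n with
  | zero => rw [hu.1, hv.1]; exact fun _ _ => rfl
  | succ n ih => exact A.isStep_unique (hu.2 n) (hv.2 n) ih

/-- Pointwise convergence of a bounded iterative sequence is uniform, to a solution. -/
theorem exists_isSolution_tendstoUniformlyOn (A : IsAdmissible M N k)
    (hf : ContinuousOn (fun z : ℝ × ℝ × ℝ => f z.1 z.2.1 z.2.2)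
      (Icc (0 : ℝ) 1 ×ˢ (univ : Set (ℝ × ℝ)))) {u : ℕ → ℝ → ℝ}
    (hu : ∀ n, ContinuousOn (u n) (Icc 0 1)) (hstep : ∀ n, IsStep f k M N (u n) (u (n + 1)))
    {B : ℝ} (hB : ∀ n, ∀ x ∈ Icc (0 : ℝ) 1, |u n x| ≤ B) {v : ℝ → ℝ}
    (hv : ∀ x ∈ Icc (0 : ℝ) 1, Tendsto (fun n => u n x) atTop (𝓝 (v x))) :
    ∃ y, IsSolution f k y ∧ TendstoUniformlyOn u y atTop (Icc 0 1) := by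
  have hk := A.continuousOn
  have hIoc : uIoc (0 : ℝ) 1 ⊆ Icc 0 1 := by
    rw [uIoc_of_le zero_le_one]; exact Ioc_subset_Icc_self
  have hmeas : ∀ {g : ℝ → ℝ}, ContinuousOn g (Icc 0 1) →
      MeasureTheory.AEStronglyMeasurable g (MeasureTheory.volume.restrict (uIoc (0 : ℝ) 1)) :=
    fun hg => (hg.mono hIoc).aestronglyMeasurable measurableSet_uIoc
  have hKlim : ∀ x ∈ Icc (0 : ℝ) 1,
      Tendsto (fun n => kernelInt k (u n) x) atTop (𝓝 (kernelInt k v x)) := fun x hx => by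
    refine intervalIntegral.tendsto_integral_filter_of_dominated_convergence
      (fun _ => supNorm k * B) (Eventually.of_forall fun n =>
        hmeas ((continuousOn_kernel_right hk hx).mul (hu n)))
      (Eventually.of_forall fun n => Eventually.of_forall fun t ht => ?_)
      intervalIntegrable_const (Eventually.of_forall fun t ht => (hv t (hIoc ht)).const_mul _)
    rw [norm_mul]
    exact mul_le_mul (abs_kernel_le_supNorm hk hx (hIoc ht)) (hB n t (hIoc ht)) (norm_nonneg _)
      (supNorm_nonneg hk)
  -- The nonlocal part of `L` is moved to the right, so that `u (n + 1)` is the Green integral of `h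
  -- n`. In the limit the two `N` terms cancel.
  let h : ℕ → ℝ → ℝ := fun n x => f x (u n x) (kernelInt k (u n) x) + M * u n x -
    N * kernelInt k (u n) x + N * kernelInt k (u (n + 1)) x
  let h' : ℝ → ℝ := fun x => f x (v x) (kernelInt k v x) + M * v x
  have hc : ∀ n, ContinuousOn (h n) (Icc 0 1) := fun n =>
    (((continuousOn_comp_kernelInt hf hk (hu n)).add (continuousOn_const.mul (hu n))).sub
      (continuousOn_const.mul (continuousOn_kernelInt hk (hu n)))).add
      (continuousOn_const.mul (continuousOn_kernelInt hk (hu (n + 1))))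
  have hlim : ∀ x ∈ Icc (0 : ℝ) 1, Tendsto (fun n => h n x) atTop (𝓝 (h' x)) := fun x hx => by
    have h1 := ((continuous_nonlinearity_right hf hx).tendsto (v x, kernelInt k v x)).comp
      ((hv x hx).prodMk_nhds (hKlim x hx))
    have h2 := ((h1.add ((hv x hx).const_mul M)).sub ((hKlim x hx).const_mul N)).add
      (((hKlim x hx).comp (tendsto_add_atTop_nat 1)).const_mul N)
    rw [sub_add_cancel] at h2
    exact h2
  obtain ⟨C, hC⟩ := exists_bound_nonlinearity hf B (supNorm k * B)
  have hKB : ∀ n, ∀ x ∈ Icc (0 : ℝ) 1, |kernelInt k (u n) x| ≤ supNorm k * B := fun n x hx =>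
    abs_kernelInt_le hk (hB n) hx
  have hbound : ∀ n, ∀ x ∈ Icc (0 : ℝ) 1,
      |h n x| ≤ C + M * B + N * (supNorm k * B) + N * (supNorm k * B) := fun n x hx => by
    refine (abs_add_le _ _).trans (add_le_add ((abs_sub _ _).trans (add_le_add
      ((abs_add_le _ _).trans (add_le_add (hC x hx _ _ (hB n x hx) (hKB n x hx)) ?_)) ?_)) ?_)
    · rw [abs_mul, abs_of_pos A.pos]
      exact mul_le_mul_of_nonneg_left (hB n x hx) A.pos.le
    all_goals
      rw [abs_mul, abs_of_nonneg A.nonneg]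
      exact mul_le_mul_of_nonneg_left (hKB _ x hx) A.nonneg
  set C' := C + M * B + N * (supNorm k * B) + N * (supNorm k * B)
  have hbound' : ∀ x ∈ Icc (0 : ℝ) 1, |h' x| ≤ C' := fun x hx =>
    le_of_tendsto (hlim x hx).abs (Eventually.of_forall fun n => hbound n x hx)
  -- Continuity of `v` is not yet known, so measurability has to come from the pointwise limit.
  have hmeas' : MeasureTheory.AEStronglyMeasurable h'
      (MeasureTheory.volume.restrict (uIoc (0 : ℝ) 1)) :=
    aestronglyMeasurable_of_tendsto_ae atTop (fun n => hmeas (hc n))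
      (MeasureTheory.ae_restrict_of_forall_mem measurableSet_uIoc fun x hx => hlim x (hIoc hx))
  have hint' : IntervalIntegrable h' MeasureTheory.volume 0 1 :=
    (intervalIntegrable_const (c := C')).mono_fun hmeas'
      (MeasureTheory.ae_restrict_of_forall_mem measurableSet_uIoc fun x hx =>
        (hbound' x (hIoc hx)).trans (le_abs_self _))
  have hint : ∀ n, IntervalIntegrable (h n) MeasureTheory.volume 0 1 := fun n =>
    (hc n).intervalIntegrable_of_Icc zero_le_one
  have hL1 : Tendsto (fun n => ∫ s in (0 : ℝ)..1, |h n s - h' s|) atTop (𝓝 0) := by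
    have := intervalIntegral.tendsto_integral_filter_of_dominated_convergence
      (μ := MeasureTheory.volume) (a := 0) (b := 1) (l := atTop)
      (F := fun n s => |h n s - h' s|) (f := fun _ => (0 : ℝ)) (fun _ => C' + C')
      (Eventually.of_forall fun n => ((hmeas (hc n)).sub hmeas').norm)
      (Eventually.of_forall fun n => Eventually.of_forall fun s hs => by
        rw [Real.norm_eq_abs, abs_abs]
        exact (abs_sub _ _).trans (add_le_add (hbound n s (hIoc hs)) (hbound' s (hIoc hs))))
      intervalIntegrable_const (Eventually.of_forall fun s hs => by
        simpa using ((hlim s (hIoc hs)).sub_const (h' s)).abs)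
    simpa using this
  obtain ⟨G, hG⟩ := (isCompact_Icc.prod isCompact_Icc).exists_bound_of_continuousOn
    ((continuous_green M).continuousOn (s := Icc (0 : ℝ) 1 ×ˢ Icc (0 : ℝ) 1))
  let w : ℝ → ℝ := fun x => ∫ s in (0 : ℝ)..1, green M x s * h' s
  have hrep : ∀ n, ∀ x ∈ Icc (0 : ℝ) 1,
      u (n + 1) x = ∫ s in (0 : ℝ)..1, green M x s * h n s := fun n x hx => by
    obtain ⟨hy, hode, b0, b1, b2, b3⟩ := hstep n
    rw [hy.eq_integral_green A.pos A.lt_c1 hx, b0, b1, b2, b3]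
    simp only [zero_mul, add_zero, sub_zero]
    refine intervalIntegral.integral_congr_Ioo_of_le zero_le_one fun s hs => ?_
    have := hode s hs
    simp only [linOp] at this
    simp only [h, ← this]
    ring
  have hdist : ∀ n, ∀ x ∈ Icc (0 : ℝ) 1,
      |u (n + 1) x - w x| ≤ G * ∫ s in (0 : ℝ)..1, |h n s - h' s| := fun n x hx => by
    have hcg := (continuous_green_right M x).continuousOn (s := uIcc 0 1)
    rw [hrep n x hx, ← intervalIntegral.integral_sub ((hint n).continuousOn_mul hcg)
      (hint'.continuousOn_mul hcg), ← intervalIntegral.integral_const_mul,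
      ← Real.norm_eq_abs]
    refine intervalIntegral.norm_integral_le_of_norm_le zero_le_one
      (Eventually.of_forall fun s hs => ?_) (((hint n).sub hint').abs.const_mul G)
    rw [← mul_sub, norm_mul]
    exact mul_le_mul_of_nonneg_right (hG (x, s) ⟨hx, Ioc_subset_Icc_self hs⟩) (abs_nonneg _)
  have hunif : TendstoUniformlyOn u w atTop (Icc 0 1) := by
    rw [Metric.tendstoUniformlyOn_iff]
    intro ε hε
    have h0 := hL1.const_mul G
    rw [mul_zero] at h0
    obtain ⟨n₀, hn₀⟩ := eventually_atTop.1 (h0.eventually (gt_mem_nhds hε))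
    filter_upwards [eventually_ge_atTop (n₀ + 1)] with n hn x hx
    obtain ⟨m, rfl⟩ : ∃ m, n = m + 1 := ⟨n - 1, by omega⟩
    rw [dist_comm, Real.dist_eq]
    exact (hdist m x hx).trans_lt (hn₀ m (by omega))
  -- Only now is `v` seen to be continuous, as a uniform limit; this makes `h'` continuous and the
  -- linear problem with forcing `h'` solvable in `C⁴`.
  have hwv : EqOn w v (Icc 0 1) := fun x hx =>
    tendsto_nhds_unique (hunif.tendsto_at hx) (hv x hx)
  have hwc : ContinuousOn w (Icc 0 1) :=
    hunif.continuousOn (Eventually.of_forall hu).frequently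
  have hvc : ContinuousOn v (Icc 0 1) := hwc.congr hwv.symm
  have hc' : ContinuousOn h' (Icc 0 1) :=
    (continuousOn_comp_kernelInt hf hk hvc).add (continuousOn_const.mul hvc)
  obtain ⟨y, hy, hbc, hode⟩ := exists_isC4_navierBC A.pos A.lt_c1 (continuous_comp_clamp hc')
  have hyw : EqOn w y (Icc 0 1) := fun x hx => by
    rw [hy.eq_integral_green A.pos A.lt_c1 hx, hbc.1, hbc.2.1, hbc.2.2.1, hbc.2.2.2]
    simp only [zero_mul, add_zero, sub_zero]
    refine intervalIntegral.integral_congr fun s hs => ?_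
    rw [uIcc_of_le zero_le_one] at hs
    simp only [hode s hs, clamp_of_mem hs]
  have hyv : EqOn y v (Icc 0 1) := hyw.symm.trans hwv
  refine ⟨y, ⟨hy, fun x hx => ?_, hbc⟩, hunif.congr_right hyw⟩
  have hx' := Ioo_subset_Icc_self hx
  have h1 := hode x hx'
  simp only [clamp_of_mem hx', h', ← hyv hx', ← kernelInt_congr hyv] at h1
  linarith

end IsAdmissible

/-! ### Monotone sequences and extremal solutions. -/

theorem IsSolution.isStep {f : ℝ → ℝ → ℝ → ℝ} {k : ℝ → ℝ → ℝ} {y : ℝ → ℝ}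
    (hy : IsSolution f k y) (M N : ℝ) : IsStep f k M N y y :=
  ⟨hy.1, fun x hx => by rw [linOp, hy.2.1 x hx], hy.2.2⟩

theorem LeI.trans {x y z : ℝ → ℝ} (h : LeI x y) (h' : LeI y z) : LeI x z := fun t ht =>
  (h t ht).trans (h' t ht)

end NavierIDE

end

open NavierIDE in
theorem theorem3p1
    (f : ℝ → ℝ → ℝ → ℝ) (k : ℝ → ℝ → ℝ) (α β : ℝ → ℝ) (M N : ℝ)
    (hf : ContinuousOn (fun z : ℝ × ℝ × ℝ => f z.1 z.2.1 z.2.2)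
      (Icc (0 : ℝ) 1 ×ˢ (univ : Set (ℝ × ℝ))))
    (hk : ContinuousOn (fun z : ℝ × ℝ => k z.1 z.2) (Icc (0 : ℝ) 1 ×ˢ Icc (0 : ℝ) 1))
    (hk0 : ∀ x ∈ Icc (0 : ℝ) 1, ∀ t ∈ Icc (0 : ℝ) 1, 0 ≤ k x t)
    (hα : NavierIDE.IsLowerSolution f k α)
    (hβ : NavierIDE.IsUpperSolution f k β)
    (hαβ : NavierIDE.LeI α β)
    (hM : 0 < M) (hMc : M < NavierIDE.c1) (hN : 0 < N)
    (hkN : NavierIDE.supNorm k < 1 / (N * NavierIDE.greenMax M))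
    (hmono : ∀ x ∈ Icc (0 : ℝ) 1, ∀ u₁ u₂ v₁ v₂ : ℝ,
      α x ≤ u₂ → u₂ ≤ u₁ → u₁ ≤ β x →
      NavierIDE.kernelInt k α x ≤ v₂ → v₂ ≤ v₁ → v₁ ≤ NavierIDE.kernelInt k β x →
      f x u₁ v₁ - f x u₂ v₂ ≥ -M * (u₁ - u₂) + N * (v₁ - v₂)) :
    ∃ (a b : ℕ → ℝ → ℝ) (ylow yhigh : ℝ → ℝ),
      -- `a` and `b` are the iterative sequences started at `α` and `β`
      NavierIDE.IsIteration f k M N α a ∧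
      (∀ a' : ℕ → ℝ → ℝ, NavierIDE.IsIteration f k M N α a' →
        ∀ n, EqOn (a' n) (a n) (Icc 0 1)) ∧
      NavierIDE.IsIteration f k M N β b ∧
      (∀ b' : ℕ → ℝ → ℝ, NavierIDE.IsIteration f k M N β b' →
        ∀ n, EqOn (b' n) (b n) (Icc 0 1)) ∧
      -- monotonicity
      (∀ n, NavierIDE.LeI (a n) (a (n + 1)) ∧ NavierIDE.LeI (a (n + 1)) (b (n + 1)) ∧
        NavierIDE.LeI (b (n + 1)) (b n)) ∧
      -- uniform convergence
      TendstoUniformlyOn a ylow atTop (Icc 0 1) ∧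
      TendstoUniformlyOn b yhigh atTop (Icc 0 1) ∧
      -- the limits are the minimal and the maximal solution in `[α, β]`
      NavierIDE.IsSolution f k ylow ∧ NavierIDE.LeI α ylow ∧ NavierIDE.LeI ylow β ∧
      NavierIDE.IsSolution f k yhigh ∧ NavierIDE.LeI α yhigh ∧ NavierIDE.LeI yhigh β ∧
      (∀ y : ℝ → ℝ, NavierIDE.IsSolution f k y → NavierIDE.LeI α y → NavierIDE.LeI y β →
        NavierIDE.LeI ylow y ∧ NavierIDE.LeI y yhigh) := by
  have hg := greenMax_nonneg hM hMc
  have A : IsAdmissible M N k := by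
    refine ⟨hM, hMc, hN.le, hk, hk0, ?_⟩
    -- Only `0 ≤ greenMax M` is at hand; if it vanishes, the product to be bounded is zero.
    rcases hg.eq_or_lt with h | h
    · rw [← h, mul_zero]; exact one_pos
    · rw [lt_div_iff₀ (by positivity)] at hkN
      linarith
  obtain ⟨a, ha⟩ := A.exists_isIteration hf hα.1
  obtain ⟨b, hb⟩ := A.exists_isIteration hf hβ.1
  have hac : ∀ n, ContinuousOn (a n) (Icc 0 1) := fun n => by
    cases n with
    | zero => rw [ha.1]; exact hα.1.continuousOn
    | succ n => exact (ha.2 n).1.continuousOn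
  have hbc : ∀ n, ContinuousOn (b n) (Icc 0 1) := fun n => by
    cases n with
    | zero => rw [hb.1]; exact hβ.1.continuousOn
    | succ n => exact (hb.2 n).1.continuousOn
  -- The condition on `f` applies only between `α` and `β`, hence the two outer bounds; `k ≥ 0`
  -- carries all three inequalities over to the integrals.
  have mono : ∀ {z₁ z₂ y₁ y₂ : ℝ → ℝ}, IsStep f k M N z₁ y₁ → IsStep f k M N z₂ y₂ →
      ContinuousOn z₁ (Icc 0 1) → ContinuousOn z₂ (Icc 0 1) → LeI α z₁ → LeI z₁ z₂ →
      LeI z₂ β → LeI y₁ y₂ := by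
    intro z₁ z₂ y₁ y₂ h₁ h₂ hc₁ hc₂ hle₁ hle hle₂
    refine A.isStep_mono h₁ h₂ fun x hx => ?_
    have := hmono x hx (z₂ x) (z₁ x) (kernelInt k z₂ x) (kernelInt k z₁ x) (hle₁ x hx) (hle x hx)
      (hle₂ x hx) (kernelInt_mono hk hk0 hα.1.continuousOn hc₁ hle₁ x hx)
      (kernelInt_mono hk hk0 hc₁ hc₂ hle x hx)
      (kernelInt_mono hk hk0 hc₂ hβ.1.continuousOn hle₂ x hx)
    linarith
  have ha01 : LeI α (a 1) := by
    have hs := ha.2 0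
    rw [ha.1] at hs
    obtain ⟨h4, hode, b0, b1, b2, b3⟩ := hs
    obtain ⟨hα4, hαode, a0, a1, a2, a3⟩ := hα
    refine A.leI_of_linOp_le hα4 h4 (fun x hx => ?_) (by rw [b0]; exact a0) (by rw [b1]; exact a1)
      (by rw [b2]; exact a2) (by rw [b3]; exact a3)
    rw [hode x hx, linOp]
    linarith [hαode x hx]
  have hb01 : LeI (b 1) β := by
    have hs := hb.2 0
    rw [hb.1] at hs
    obtain ⟨h4, hode, b0, b1, b2, b3⟩ := hs
    obtain ⟨hβ4, hβode, a0, a1, a2, a3⟩ := hβ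
    refine A.leI_of_linOp_le h4 hβ4 (fun x hx => ?_) (by rw [b0]; exact a0) (by rw [b1]; exact a1)
      (by rw [b2]; exact a2) (by rw [b3]; exact a3)
    rw [hode x hx, linOp]
    linarith [hβode x hx]
  -- The bounds by `α` and `β` are carried through the induction because `mono` requires them at
  -- every step.
  have main : ∀ n, LeI α (a n) ∧ LeI (a n) (a (n + 1)) ∧ LeI (a (n + 1)) (b (n + 1)) ∧
      LeI (b (n + 1)) (b n) ∧ LeI (b n) β := by
    intro n
    induction n with
    | zero =>
      have ha0 := ha.1
      have hb0 := hb.1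
      refine ⟨by rw [ha0]; exact fun _ _ => le_rfl, by rw [ha0]; exact ha01, ?_,
        by rw [hb0]; exact hb01, by rw [hb0]; exact fun _ _ => le_rfl⟩
      exact mono (ha.2 0) (hb.2 0) (hac 0) (hbc 0) (by rw [ha0]; exact fun _ _ => le_rfl)
        (by rw [ha0, hb0]; exact hαβ) (by rw [hb0]; exact fun _ _ => le_rfl)
    | succ n ih =>
      obtain ⟨h1, h2, h3, h4, h5⟩ := ih
      have l1 := h1.trans h2
      have l2 := h4.trans h5
      exact ⟨l1, mono (ha.2 n) (ha.2 (n + 1)) (hac n) (hac (n + 1)) h1 h2 (h3.trans l2),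
        mono (ha.2 (n + 1)) (hb.2 (n + 1)) (hac (n + 1)) (hbc (n + 1)) l1 h3 l2,
        mono (hb.2 (n + 1)) (hb.2 n) (hbc (n + 1)) (hbc n) (l1.trans h3) h4 h5, l2⟩
  have haα : ∀ n, LeI α (a n) := fun n => (main n).1
  have hbβ : ∀ n, LeI (b n) β := fun n => (main n).2.2.2.2
  have haβ : ∀ n, LeI (a n) β := fun n =>
    (main n).2.1.trans ((main n).2.2.1.trans (hbβ (n + 1)))
  have hbα : ∀ n, LeI α (b n) := fun n =>
    (haα (n + 1)).trans ((main n).2.2.1.trans (main n).2.2.2.1)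
  obtain ⟨B₁, hB₁⟩ := isCompact_Icc.exists_bound_of_continuousOn hα.1.continuousOn
  obtain ⟨B₂, hB₂⟩ := isCompact_Icc.exists_bound_of_continuousOn hβ.1.continuousOn
  have hbd : ∀ {y : ℝ → ℝ}, LeI α y → LeI y β → ∀ x ∈ Icc (0 : ℝ) 1, |y x| ≤ max B₁ B₂ := by
    intro y h1 h2 x hx
    refine (abs_le_max_abs_abs (h1 x hx) (h2 x hx)).trans (max_le_max (hB₁ x hx) (hB₂ x hx))
  obtain ⟨ylow, hlow, hulow⟩ := A.exists_isSolution_tendstoUniformlyOn hf hac ha.2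
    (fun n => hbd (haα n) (haβ n)) (v := fun x => ⨆ n, a n x) fun x hx =>
      tendsto_atTop_ciSup (monotone_nat_of_le_succ fun n => (main n).2.1 x hx)
        ⟨β x, forall_mem_range.2 fun n => haβ n x hx⟩
  obtain ⟨yhigh, hhigh, huhigh⟩ := A.exists_isSolution_tendstoUniformlyOn hf hbc hb.2
    (fun n => hbd (hbα n) (hbβ n)) (v := fun x => ⨅ n, b n x) fun x hx =>
      tendsto_atTop_ciInf (antitone_nat_of_succ_le fun n => (main n).2.2.2.1 x hx)
        ⟨α x, forall_mem_range.2 fun n => hbα n x hx⟩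
  have low_le : ∀ {y : ℝ → ℝ}, (∀ n, LeI (a n) y) → LeI ylow y := fun h x hx =>
    le_of_tendsto' (hulow.tendsto_at hx) fun n => h n x hx
  have le_high : ∀ {y : ℝ → ℝ}, (∀ n, LeI y (b n)) → LeI y yhigh := fun h x hx =>
    ge_of_tendsto' (huhigh.tendsto_at hx) fun n => h n x hx
  refine ⟨a, b, ylow, yhigh, ha, fun a' ha' => A.isIteration_unique ha' ha, hb,
    fun b' hb' => A.isIteration_unique hb' hb,
    fun n => ⟨(main n).2.1, (main n).2.2.1, (main n).2.2.2.1⟩, hulow, huhigh, hlow,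
    fun x hx => ge_of_tendsto' (hulow.tendsto_at hx) fun n => haα n x hx, low_le haβ, hhigh,
    le_high hbα, fun x hx => le_of_tendsto' (huhigh.tendsto_at hx) fun n => hbβ n x hx,
    fun y hy hαy hyβ => ⟨low_le fun n => ?_, le_high fun n => ?_⟩⟩
  -- The solution `y` is a step from itself, so `mono` compares it with the next iterate.
  · induction n with
    | zero => rw [ha.1]; exact hαy
    | succ n ih =>
      exact mono (ha.2 n) (hy.isStep M N) (hac n) hy.1.continuousOn (haα n) ih hyβ
  · induction n with
    | zero => rw [hb.1]; exact hyβ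
    | succ n ih =>
      exact mono (hy.isStep M N) (hb.2 n) hy.1.continuousOn (hbc n) hαy ih (hbβ n)
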